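/- **Setting.** Let $\mathcal M$ be a finite set of stations, each with a cache containing some files of a finite catalog, and let finitely many regions be given, each covered by some of the stations. A *region-file* is a pair $q=(s,f)$ such that at least one station covers $s$ and caches $f$; $\mathcal M(q)\neq\emptyset$ is the set of these stations, $\mathcal Q$ the set of region-files, and $\mathcal Q(m)=\{q: m\in\mathcal M(q)\}$. Let $N_q\ge 0$ for $q\in\mathcal Q$. Routing vectors are $y=(y_{m,q})_{m\in\mathcal M,\,q\in\mathcal Q(m)}$, with partial vectors $y_m=(y_{m,q})_{q\in\mathcal Q(m)}$ and volumes $v_m(y_m)=\sum_{q\in\mathcal Q(m)}y_{m,q}$. Each utility $U_m$ is increasing (not necessarily strictly), concave and continuously differentiable on $(0,\infty)$, with $U_m(0)=\lim_{v\to0+}U_m(v)\in[-\infty,\infty)$; if $U_m(0)=-\infty$ (e.g. $U_m=\log$), assume $N_q>0$ for some $q\in\mathcal Q(m)$. The *Cache Routing Problem* is $$(\mathrm{CRP})\qquad \max_{0\le y_{m,q}\le N_q}\ \sum_{m}U_m(v_m(y_m))\quad\text{s.t.}\quad \sum_{m\in\mathcal M(q)}y_{m,q}=N_q\ \ (q\in\mathcal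 Q).$$ Let $\varrho>0$, and let $0<\alpha\le1$ satisfy $\alpha\,|\mathcal M(q)|<2$ for all $q\in\mathcal Q$. For $\lambda\in\mathbb R^{\mathcal Q}$ put $$L(y,\lambda)=\sum_mU_m(v_m(y_m))-\sum_q\lambda_q\Big(N_q-\sum_{m\in\mathcal M(q)}y_{m,q}\Big)-\frac{\varrho}{2}\sum_q\Big(N_q-\sum_{m\in\mathcal M(q)}y_{m,q}\Big)^2,$$ $D(\lambda)=\max_{0\le y_{m,q}\le N_q}L(y,\lambda)$, and, with $\bar N^m_q(\tilde y)=N_q-\sum_{\bar m\in\mathcal M(q),\,\bar m\ne m}\tilde y_{\bar m,q}$, $$L_m(y_m,\tilde y,\lambda)=U_m(v_m(y_m))+\sum_{q\in\mathcal Q(m)}\lambda_qy_{m,q}-\frac{\varrho}{2}\sum_{q\in\mathcal Q(m)}\big(\bar N^m_q(\tilde y)-y_{m,q}\big)^2 .$$ **The scheme.** *Bucket-filling* at station $m$, for given $\tilde y,\lambda$: let $a_q=\lambda_q+\varrho\bar N^m_q(\tilde y)$ for $q\in\mathcal Q(m)$; start with $y_m=0$ and declare the $q$ with maximal $a_q$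 active. Repeat: increase $y_{m,q}$ of all active $q$ equally until (i) a not yet activated $q$ becomes active, because $a_p-\varrho y_{m,p}=a_q$ for the active $p$, or (ii) an active $q$ is full ($y_{m,q}=N_q$) and becomes inactive, or (iii) $U_m'(v_m)-(\varrho y_{m,q}-a_q)\le0$ for all active $q$. If no $q$ is active, activate those with maximal $a_q$ among the not yet activated ones. Stop when (iii) holds with some $q$ active, or when all $q$ are full. *Inner loop*, for given $\lambda$: from any $\tilde y(0)$ in the box $\{0\le y_{m,q}\le N_q\}$, iterate $\tilde y(\tau+1)=\tilde y(\tau)+\alpha\,(\tilde y^*(\tau)-\tilde y(\tau))$, where $\tilde y^*_m(\tau)$ is the result of Bucket-filling at $m$ for $\tilde y(\tau),\lambda$. *Outer loop*: from any $\lambda(0)$, set $\lambda_q(t+1)=\lambda_q(t)+\varrho\big(N_q-\sum_{m\in\mathcal M(q)}y_{m,q}(t)\big)$, where $y(t)$ is the result of the inner loop for $\lambda(t)$; the start vector of each inner loop is an arbitrary point of the box. **Theorem.** CRP has a global optimum. Moreover: 1. For all $\lambda$, $\tilde y$ and $m$, Bucket-filling stops after at most $2|\mathcal Q(m)|$ passes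 and returns the unique maximizer of $L_m(\cdot,\tilde y,\lambda)$ over $0\le y_{m,q}\le N_q$. 2. For every $\lambda$ and every start vector in the box, the inner iterates converge, and the limit maximizes $L(\cdot,\lambda)$ over the box. 3. If each $y(t)$ is the limit of its inner loop, then $\lambda(t)$ converges to a minimizer $\lambda^*$ of $D$, $D(\lambda^*)$ equals the optimal value of CRP, the distance from $y(t)$ to the set of global optima of CRP tends to $0$, and $\sum_mU_m(v_m(y_m(t)))$ tends to the optimal value of CRP. 4. Let the inner loops stop at the first $\tau\ge1$ with $\|\tilde y(\tau)-\tilde y(\tau-1)\|\le\delta$ and the outer loop at the first $t\ge1$ with $\|\lambda(t)-\lambda(t-1)\|\le\varepsilon$ (maximum norms). For every $\lambda(0)$ and $\eta>0$ there is $\varepsilon_0>0$ such that for every $\varepsilon\in(0,\varepsilon_0]$ there is $\delta_0>0$ such that for every $\delta\in(0,\delta_0]$ and all choices of the start vectors in the box, the scheme stops, and the last computed routing vector has distance less than $\eta$ to the set of global optima of CRP and an objective value that differs by less than $\eta$ from the optimal value. 5. The scheme is distributed: an inner update of $\tilde y_m$ depends only on $U_m$ and on $N_q$, $\lambda_q$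 and $(\tilde y_{\bar m,q})_{\bar m\in\mathcal M(q)}$ for $q\in\mathcal Q(m)$, and an update of $\lambda_q$ only on $\lambda_q$, $N_q$ and $(y_{m,q})_{m\in\mathcal M(q)}$ (besides the constants $\varrho,\alpha$). -/

import Mathlib

open Set Filter Topology

/-! ### The network -/

/-- Cached base stations `M`, regions `S` and a catalog of files `F`: the (possibly overlapping)
coverage areas enter through the set of stations that cover each region, and `cache m` is the set
of files stored at station `m`. -/
structure CacheNetwork (M S F : Type*) where
  covers : S → Finset M
  cache : M → Finset F

namespace CacheNetwork

variable {M S F : Type*} [Fintype M] [DecidableEq M] [Fintype S] [Fintype F] [DecidableEq F]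

/-- Region-files: the pairs `(s, f)` for which some station covers `s` and caches `f`. -/
abbrev RegionFile (G : CacheNetwork M S F) : Type _ :=
  {q : S × F // ∃ m ∈ G.covers q.1, q.2 ∈ G.cache m}

/-- The stations that cover the region of `q` and cache the file of `q`. -/
def stations (G : CacheNetwork M S F) (q : G.RegionFile) : Finset M :=
  {m ∈ G.covers q.1.1 | q.1.2 ∈ G.cache m}

/-- The stations that can serve `q`, as a type. -/
abbrev StationsOf (G : CacheNetwork M S F) (q : G.RegionFile) : Type _ :=
  {m : M // m ∈ G.stations q}

/-- The region-files that can be served by the cache of `m`. -/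
abbrev Served (G : CacheNetwork M S F) (m : M) : Type _ :=
  {q : G.RegionFile // m ∈ G.stations q}

/-- Routing vectors `y = (y_{m,q})`, indexed by the stations `m` and the region-files `q` that
`m` can serve; `y m` is the partial vector of station `m`. -/
abbrev Routing (G : CacheNetwork M S F) : Type _ := (m : M) → G.Served m → ℝ

/-- Price vectors, one price per region-file. -/
abbrev Prices (G : CacheNetwork M S F) : Type _ := G.RegionFile → ℝ

end CacheNetwork

/-! ### Utilities -/

/-- A utility function of the traffic volume: increasing, concave and continuously differentiable
on `(0, ∞)`. At volume `0` it takes its limit value, which is either finite (and then `u` is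
continuous at `0`) or `-∞` (for instance `log`; the real number `u 0` is then meaningless, and
the volume `0` is excluded by `volumeDomain`). -/
structure IsUtility (u : ℝ → ℝ) : Prop where
  mono : MonotoneOn u (Ioi 0)
  concave : ConcaveOn ℝ (Ioi 0) u
  smooth : ContDiffOn ℝ 1 u (Ioi 0)
  at_zero : ContinuousWithinAt u (Ici 0) 0 ∨ Tendsto u (𝓝[>] 0) atBot

/-- The volumes at which a utility is finite. -/
def volumeDomain (u : ℝ → ℝ) : Set ℝ :=
  {v | 0 < v ∨ (v = 0 ∧ ContinuousWithinAt u (Ici 0) 0)}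

/-! ### Bucket-filling at one station -/

namespace BucketFilling

/-- The state of the procedure: the current routing vector, the active buckets, and the buckets
that have not been activated yet. Buckets in neither set have been active and are full. -/
structure State (ι : Type*) where
  y : ι → ℝ
  active : Finset ι
  pending : Finset ι

section
variable {ι : Type*} [Fintype ι]

/-- The partial derivative `u'(∑ y) - (ρ y_q - a_q)` of the objective in the direction of `q`
is nonpositive. (If `u` has slope `+∞` at volume `0`, this fails at volume `0`.) -/
def GradNonpos (u : ℝ → ℝ) (ρ : ℝ) (a y : ι → ℝ) (q : ι) : Prop :=
  ∃ u' : ℝ, HasDerivWithinAt u u' (Ici 0) (∑ p, y p) ∧ u' - (ρ * y q - a q) ≤ 0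

open Classical in
/-- The elements of `s` with maximal value of `a`. -/
noncomputable def top (a : ι → ℝ) (s : Finset ι) : Finset ι :=
  {q ∈ s | ∀ p ∈ s, a p ≤ a q}

open Classical in
/-- All variables are zero, and the buckets with maximal `a` are active. -/
noncomputable def init (a : ι → ℝ) : State ι where
  y := 0
  active := top a Finset.univ
  pending := Finset.univ \ top a Finset.univ

/-- The termination test: increasing the active variables no longer increases the objective, or
all buckets are full. -/
def Halted (u : ℝ → ℝ) (ρ : ℝ) (N a : ι → ℝ) (s : State ι) : Prop :=
  (s.active.Nonempty ∧ ∀ q ∈ s.active, GradNonpos u ρ a s.y q) ∨ ∀ q, s.y q = N q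

open Classical in
/-- Increase the active variables equally by `θ`. -/
noncomputable def raise (s : State ι) (θ : ℝ) : ι → ℝ :=
  fun q => if q ∈ s.active then s.y q + θ else s.y q

/-- The pending bucket `q` becomes active: the water level, at which the gradient of an active
bucket `p` falls to that of `q`, is reached (`a_p - ρ y_p = a_q` with `y_q = 0`). -/
def Activates (ρ : ℝ) (a : ι → ℝ) (s : State ι) (y : ι → ℝ) (q : ι) : Prop :=
  q ∈ s.pending ∧ ∃ p ∈ s.active, a p - ρ * y p ≤ a q

/-- The events that end an increase by `θ`: a pending bucket becomes active, an active bucket is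
full, or the gradient has decreased to zero for all active buckets. -/
def Event (u : ℝ → ℝ) (ρ : ℝ) (N a : ι → ℝ) (s : State ι) (θ : ℝ) : Prop :=
  (∃ q, Activates ρ a s (raise s θ) q) ∨
  (∃ q ∈ s.active, raise s θ q = N q) ∨
  (∀ q ∈ s.active, GradNonpos u ρ a (raise s θ) q)

/-- The amount of the increase: up to the first event. -/
noncomputable def increment (u : ℝ → ℝ) (ρ : ℝ) (N a : ι → ℝ) (s : State ι) : ℝ :=
  sInf {θ : ℝ | 0 ≤ θ ∧ Event u ρ N a s θ}

open Classical in
/-- One pass through the loop. A state that passes the termination test is left unchanged. If all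
activated buckets are full, the water level rises to the next pending buckets. -/
noncomputable def step (u : ℝ → ℝ) (ρ : ℝ) (N a : ι → ℝ) (s : State ι) : State ι :=
  if Halted u ρ N a s then s
  else if s.active = ∅ then
    { y := s.y
      active := top a s.pending
      pending := s.pending \ top a s.pending }
  else
    let y' := raise s (increment u ρ N a s)
    let new : Finset ι := {q ∈ s.pending | Activates ρ a s y' q}
    { y := y'
      active := {q ∈ s.active | y' q ≠ N q} ∪ new
      pending := s.pending \ new }

/-- The state after `n` passes through the loop. -/
noncomputable def run (u : ℝ → ℝ) (ρ : ℝ) (N a : ι → ℝ) (n : ℕ) : State ι :=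
  (step u ρ N a)^[n] (init a)

/-- The vector returned by Bucket-filling. The loop is allowed twice as many passes as there are
buckets; that the termination test succeeds by then is part of what is to be proved, and further
passes change nothing. -/
noncomputable def output (u : ℝ → ℝ) (ρ : ℝ) (N a : ι → ℝ) : ι → ℝ :=
  (run u ρ N a (2 * Fintype.card ι)).y

end

end BucketFilling

/-! ### The Cache Routing Problem and the nested scheme -/

namespace CacheNetwork

section
variable {M S F : Type*} [Fintype M] [DecidableEq M] [Fintype S] [Fintype F] [DecidableEq F]
variable (G : CacheNetwork M S F)

/-- The traffic volume `∑_q y_{m,q}` of station `m`. -/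
def volume {m : M} (ym : G.Served m → ℝ) : ℝ := ∑ q, ym q

/-- The total traffic `∑_{m} y_{m,q}` routed for `q`, over the stations that can serve `q`. -/
def routed (y : G.Routing) (q : G.RegionFile) : ℝ :=
  ∑ m : G.StationsOf q, y m.1 ⟨q, m.2⟩

/-- The box `0 ≤ y_m ≤ N_m` for all `m`. -/
def box (N : G.RegionFile → ℝ) : Set G.Routing :=
  {y | ∀ m q, 0 ≤ y m q ∧ y m q ≤ N q.1}

/-- The routing vectors in the box at which all utilities are finite. -/
def primalDomain (N : G.RegionFile → ℝ) (U : M → ℝ → ℝ) : Set G.Routing :=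
  {y | y ∈ G.box N ∧ ∀ m, G.volume (y m) ∈ volumeDomain (U m)}

/-- The same for the partial vector of station `m`. -/
def stationDomain (N : G.RegionFile → ℝ) (u : ℝ → ℝ) (m : M) : Set (G.Served m → ℝ) :=
  {ym | (∀ q, 0 ≤ ym q ∧ ym q ≤ N q.1) ∧ G.volume ym ∈ volumeDomain u}

/-- The sum of the utilities, which is the objective of CRP. -/
def totalUtility (U : M → ℝ → ℝ) (y : G.Routing) : ℝ := ∑ m, U m (G.volume (y m))

/-- The feasible set of CRP: the box with the constraints `∑_m y_{m,q} = N_q`. -/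
def crpFeasible (N : G.RegionFile → ℝ) (U : M → ℝ → ℝ) : Set G.Routing :=
  {y | y ∈ G.primalDomain N U ∧ ∀ q, G.routed y q = N q}

/-- The global optima of CRP. -/
def crpOptima (N : G.RegionFile → ℝ) (U : M → ℝ → ℝ) : Set G.Routing :=
  {y | y ∈ G.crpFeasible N U ∧ IsMaxOn (G.totalUtility U) (G.crpFeasible N U) y}

/-- The Augmented Lagrangian. -/
noncomputable def augLagrangian (N : G.RegionFile → ℝ) (U : M → ℝ → ℝ) (ρ : ℝ)
    (lam : G.Prices) (y : G.Routing) : ℝ :=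
  G.totalUtility U y - ∑ q, lam q * (N q - G.routed y q)
    - ρ / 2 * ∑ q, (N q - G.routed y q) ^ 2

/-- The dual objective: the maximum of the Augmented Lagrangian over the primal domain. -/
noncomputable def dualObjective (N : G.RegionFile → ℝ) (U : M → ℝ → ℝ) (ρ : ℝ)
    (lam : G.Prices) : ℝ :=
  sSup (G.augLagrangian N U ρ lam '' G.primalDomain N U)

/-- The requests `N_q - ∑_{m' ≠ m} y_{m',q}` that `y` leaves to station `m`. -/
def leftover (N : G.RegionFile → ℝ) (y : G.Routing) (m : M) (q : G.Served m) : ℝ :=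
  N q.1 - ∑ m' : G.StationsOf q.1, if m'.1 = m then 0 else y m'.1 ⟨q.1, m'.2⟩

/-- The separated objective of station `m` (Diagonal Quadratic Approximation around `y`). -/
noncomputable def stationObjective (N : G.RegionFile → ℝ) (U : M → ℝ → ℝ) (ρ : ℝ)
    (lam : G.Prices) (y : G.Routing) (m : M) (ym : G.Served m → ℝ) : ℝ :=
  U m (G.volume ym) + ∑ q, lam q.1 * ym q - ρ / 2 * ∑ q, (G.leftover N y m q - ym q) ^ 2

/-- The coefficients `a_q = λ_q + ρ (N_q - ∑_{m' ≠ m} y_{m',q})` of Bucket-filling at `m`. -/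
def bucketCoeff (N : G.RegionFile → ℝ) (ρ : ℝ) (lam : G.Prices) (y : G.Routing) (m : M)
    (q : G.Served m) : ℝ :=
  lam q.1 + ρ * G.leftover N y m q

/-- The result of Bucket-filling at station `m`. -/
noncomputable def stationSolve (N : G.RegionFile → ℝ) (U : M → ℝ → ℝ) (ρ : ℝ)
    (lam : G.Prices) (y : G.Routing) (m : M) : G.Served m → ℝ :=
  BucketFilling.output (U m) ρ (fun q => N q.1) (G.bucketCoeff N ρ lam y m)

/-- One iteration of the inner loop (nonlinear Jacobi with relaxation `α`): all stations run
Bucket-filling in parallel. -/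
noncomputable def innerStep (N : G.RegionFile → ℝ) (U : M → ℝ → ℝ) (ρ α : ℝ)
    (lam : G.Prices) (y : G.Routing) : G.Routing :=
  fun m q => y m q + α * (G.stationSolve N U ρ lam y m q - y m q)

/-- The `τ`-th iterate of the inner loop started at `y₀`. -/
noncomputable def innerIter (N : G.RegionFile → ℝ) (U : M → ℝ → ℝ) (ρ α : ℝ)
    (lam : G.Prices) (y₀ : G.Routing) (τ : ℕ) : G.Routing :=
  (G.innerStep N U ρ α lam)^[τ] y₀

/-- The dual update `λ_q + ρ (N_q - ∑_m y_{m,q})`. -/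
def dualUpdate (N : G.RegionFile → ℝ) (ρ : ℝ) (lam : G.Prices) (y : G.Routing) : G.Prices :=
  fun q => lam q + ρ * (N q - G.routed y q)

/-- The scheme with every inner loop run to its limit: `lam t` are the prices, `start t` is the
(arbitrary) first vector of the `t`-th inner loop and `y t` its limit. -/
structure IsExactRun (N : G.RegionFile → ℝ) (U : M → ℝ → ℝ) (ρ α : ℝ)
    (lam : ℕ → G.Prices) (start y : ℕ → G.Routing) : Prop where
  start_mem : ∀ t, start t ∈ G.box N
  inner : ∀ t, Tendsto (G.innerIter N U ρ α (lam t) (start t)) atTop (𝓝 (y t))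
  outer : ∀ t, lam (t + 1) = G.dualUpdate N ρ (lam t) (y t)

end

end CacheNetwork

/-- `k` is the index at which a loop producing `x` stops that runs while
`‖x k - x (k - 1)‖ > ε` (the test being void for the first pass). -/
def StopsAt {E : Type*} [Norm E] [Sub E] (x : ℕ → E) (ε : ℝ) (k : ℕ) : Prop :=
  IsLeast {k : ℕ | 1 ≤ k ∧ ‖x k - x (k - 1)‖ ≤ ε} k

namespace CacheNetwork

section
variable {M S F : Type*} [Fintype M] [DecidableEq M] [Fintype S] [Fintype F] [DecidableEq F]
variable (G : CacheNetwork M S F)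

/-- The scheme with every inner loop stopped by the test with tolerance `δ`. -/
structure IsTruncatedRun (N : G.RegionFile → ℝ) (U : M → ℝ → ℝ) (ρ α δ : ℝ)
    (lam : ℕ → G.Prices) (start y : ℕ → G.Routing) : Prop where
  start_mem : ∀ t, start t ∈ G.box N
  inner : ∀ t, ∃ τ, StopsAt (G.innerIter N U ρ α (lam t) (start t)) δ τ ∧
    y t = G.innerIter N U ρ α (lam t) (start t) τ
  outer : ∀ t, lam (t + 1) = G.dualUpdate N ρ (lam t) (y t)

end

end CacheNetwork

set_option linter.unusedSectionVars false

/-! ### Utilities on their domain -/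

/-! Write F for the total utility and r(y) for the vector of unserved requests, so that L = F - ⟨λ,
r⟩ - (ρ/2)|r|².

Bucket-filling is water-filling. The levels a_q - ρ y_q agree on the active buckets, are at least as
high on the full ones and at most as high on the pending ones, and the gradient is nonnegative where
y_q > 0. At a halted state these relations are the KKT conditions of a strongly concave problem
(`Invariant.optimal`). Passes that do not lead to a halt decrease an integer rank
(`step_halted_or_rank_lt`).

Bucket-filling at all stations in parallel is a proximal gradient step for L: by `leftover_eq` the
stations together maximize F(w) + ⟨λ + ρ r(y), routed w⟩ - (ρ/2)|w - y|², which yields the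
three-point inequality `jacobi_variational`. Since α|M(q)| ≤ β < 2, the coupling between stations
costs less than the proximal term gains, and a combination of squared distance and value gap
decreases (`lyapunov_scalar`). Hence the values of L converge to the maximum, and monotonicity
relative to a cluster point makes that point the limit.

The outer loop is the method of multipliers. A maximizer of L at the old prices maximizes the
ordinary Lagrangian at the new ones (`lagrangian_le_of_isMaxOn`). Comparison with a multiplier λ*
gives |λ(t+1) - λ*|² + ρ²|r|² ≤ |λ(t) - λ*|², so r tends to 0 and the prices converge. A multiplier
is built from marginal utilities by an exchange argument (`exists_isMultiplier`). With stopping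
tests the same inequality carries an error that compactness makes uniformly small over bounded
prices (`innerStep_nearly_optimal`).

Utilities may be -∞ or have infinite slope at volume 0, so the primal domain need not be closed.
Therefore compactness is drawn from superlevel sets of F, and derivative conditions are turned into
secant inequalities, which survive limits. -/

lemma volumeDomain_subset_Ici (u : ℝ → ℝ) : volumeDomain u ⊆ Ici 0 := by
  rintro v (h | ⟨rfl, -⟩)
  · exact h.le
  · exact self_mem_Ici

lemma add_mem_Ioi_of_mem_volumeDomain {u : ℝ → ℝ} {v e : ℝ} (hv : v ∈ volumeDomain u)
    (he : 0 < e) : v + e ∈ Ioi (0 : ℝ) :=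
  mem_Ioi.2 <| add_pos_of_nonneg_of_pos (volumeDomain_subset_Ici u hv) he

lemma mem_volumeDomain_of_continuous {u : ℝ → ℝ} (hu : ContinuousWithinAt u (Ici 0) 0) {v : ℝ}
    (hv : 0 ≤ v) : v ∈ volumeDomain u := by
  rcases hv.eq_or_lt with rfl | h
  · exact Or.inr ⟨rfl, hu⟩
  · exact Or.inl h

lemma mem_volumeDomain_of_le {u : ℝ → ℝ} {v w : ℝ} (hv : v ∈ volumeDomain u) (h : v ≤ w) :
    w ∈ volumeDomain u := by
  rcases hv with hv | ⟨rfl, hc⟩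
  · exact Or.inl (hv.trans_le h)
  · exact mem_volumeDomain_of_continuous hc h

lemma combo_mem_volumeDomain {u : ℝ → ℝ} {v w t : ℝ} (hv : 0 ≤ v) (hw : w ∈ volumeDomain u)
    (ht : 0 < t) (ht1 : t ≤ 1) : v + t * (w - v) ∈ volumeDomain u := by
  have hvt : 0 ≤ (1 - t) * v := mul_nonneg (by linarith) hv
  rcases hw with hw | ⟨rfl, hc⟩
  · exact Or.inl (by nlinarith [mul_pos ht hw])
  · exact mem_volumeDomain_of_continuous hc (by nlinarith)

lemma convex_volumeDomain (u : ℝ → ℝ) : Convex ℝ (volumeDomain u) := by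
  intro v hv w hw a b ha hb hab
  obtain rfl : a = 1 - b := by linarith
  rcases hb.eq_or_lt with rfl | hb
  · simpa using hv
  · have := combo_mem_volumeDomain (volumeDomain_subset_Ici u hv) hw hb (by linarith)
    convert this using 1
    simp only [smul_eq_mul]; ring

namespace IsUtility

variable {u : ℝ → ℝ}

lemma continuousOn (hu : IsUtility u) : ContinuousOn u (volumeDomain u) := by
  rintro v (hv | ⟨rfl, hc⟩)
  · exact ((hu.smooth.continuousOn).continuousAt (Ioi_mem_nhds hv)).continuousWithinAt
  · exact hc.mono (volumeDomain_subset_Ici u)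

lemma tendsto_add_right (hu : IsUtility u) {v : ℝ} (hv : v ∈ volumeDomain u) :
    Tendsto (fun e => u (v + e)) (𝓝[>] 0) (𝓝 (u v)) := by
  have h := hu.continuousOn v hv
  refine h.tendsto.comp (tendsto_nhdsWithin_iff.2 ⟨?_, ?_⟩)
  · have : Tendsto (fun e : ℝ => v + e) (𝓝 0) (𝓝 (v + 0)) := by
      exact (continuous_const.add continuous_id).tendsto 0
    rw [add_zero] at this
    exact this.mono_left nhdsWithin_le_nhds
  · filter_upwards [self_mem_nhdsWithin] with e he
    exact Or.inl (add_mem_Ioi_of_mem_volumeDomain hv he)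

/-- The inequality on (0, ∞) is applied to the volumes shifted by e > 0; continuity on the domain
allows e → 0. -/
lemma concaveOn (hu : IsUtility u) : ConcaveOn ℝ (volumeDomain u) u := by
  refine ⟨convex_volumeDomain u, fun v hv w hw a b ha hb hab => ?_⟩
  refine le_of_tendsto_of_tendsto (((hu.tendsto_add_right hv).const_smul a).add
    ((hu.tendsto_add_right hw).const_smul b))
    (hu.tendsto_add_right (convex_volumeDomain u hv hw ha hb hab)) ?_
  filter_upwards [self_mem_nhdsWithin] with e he
  have := hu.concave.2 (x := v + e) (y := w + e)
    (add_mem_Ioi_of_mem_volumeDomain hv he)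
    (add_mem_Ioi_of_mem_volumeDomain hw he) ha hb hab
  refine this.trans_eq (congrArg u ?_)
  simp only [smul_eq_mul]
  linear_combination e * hab

lemma monotoneOn (hu : IsUtility u) : MonotoneOn u (volumeDomain u) := by
  intro v hv w hw hvw
  refine le_of_tendsto_of_tendsto (hu.tendsto_add_right hv) (hu.tendsto_add_right hw) ?_
  filter_upwards [self_mem_nhdsWithin] with e he
  exact hu.mono (add_mem_Ioi_of_mem_volumeDomain hv he)
    (add_mem_Ioi_of_mem_volumeDomain hw he) (by linarith)

lemma hasDerivAt (hu : IsUtility u) {v : ℝ} (hv : 0 < v) : HasDerivAt u (deriv u v) v :=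
  ((hu.smooth.differentiableOn (by norm_num)).differentiableAt (Ioi_mem_nhds hv)).hasDerivAt

lemma continuousOn_deriv (hu : IsUtility u) : ContinuousOn (deriv u) (Ioi 0) :=
  hu.smooth.continuousOn_deriv_of_isOpen isOpen_Ioi le_rfl

lemma mem_volumeDomain_of_hasDerivWithinAt {v d : ℝ} (hv : 0 ≤ v)
    (h : HasDerivWithinAt u d (Ici 0) v) : v ∈ volumeDomain u := by
  rcases hv.eq_or_lt with rfl | hv
  · exact Or.inr ⟨rfl, h.continuousWithinAt⟩
  · exact Or.inl hv

lemma le_tangent (hu : IsUtility u) {v w d : ℝ} (hv : 0 ≤ v) (hw : w ∈ volumeDomain u)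
    (h : HasDerivWithinAt u d (Ici 0) v) : u w ≤ u v + d * (w - v) := by
  have hv' := mem_volumeDomain_of_hasDerivWithinAt hv h
  have h' := h.mono (volumeDomain_subset_Ici u)
  rcases lt_trichotomy v w with hlt | rfl | hlt
  · have := hu.concaveOn.slope_le_of_hasDerivWithinAt hv' hw hlt h'
    rw [slope_def_field, div_le_iff₀ (by linarith)] at this
    linarith
  · simp
  · have := hu.concaveOn.le_slope_of_hasDerivWithinAt hw hv' hlt h'
    rw [slope_def_field, le_div_iff₀ (by linarith)] at this
    linarith

/-- A lower bound on the utilities excludes the limit volume 0 when the utility is -∞ there. This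
replaces closedness of the domain. -/
lemma mem_volumeDomain_of_tendsto (hu : IsUtility u) {ι : Type*} {l : Filter ι} [l.NeBot]
    {x : ι → ℝ} {v B : ℝ} (hx : Tendsto x l (𝓝 v)) (hd : ∀ᶠ n in l, x n ∈ volumeDomain u)
    (hB : ∀ᶠ n in l, B ≤ u (x n)) : v ∈ volumeDomain u := by
  have hv : 0 ≤ v := ge_of_tendsto hx (hd.mono fun n hn => volumeDomain_subset_Ici u hn)
  rcases hv.eq_or_lt with rfl | hv
  · rcases hu.at_zero with hc | hbot
    · exact Or.inr ⟨rfl, hc⟩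
    · by_contra h0
      have h1 : ∀ᶠ n in l, x n ∈ Ioi (0 : ℝ) := by
        filter_upwards [hd] with n hn
        rcases hn with hn | ⟨h, hc⟩
        · exact hn
        · exact absurd (Or.inr ⟨rfl, hc⟩) h0
      have h2 := hbot.comp (tendsto_nhdsWithin_iff.2 ⟨hx, h1⟩)
      obtain ⟨n, hn1, hn2⟩ := (hB.and (h2.eventually (eventually_lt_atBot B))).exists
      exact absurd hn1 (not_le.2 hn2)
  · exact Or.inl hv

/-- The right derivative at `v` exists and is at most `c` if and only if all secants to the right
of `v` have slope at most `c`. -/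
lemma exists_hasDerivWithinAt_le_iff (hu : IsUtility u) {v c : ℝ} (hv : 0 ≤ v) :
    (∃ d, HasDerivWithinAt u d (Ici 0) v ∧ d ≤ c) ↔
      v ∈ volumeDomain u ∧ ∀ w, v < w → u w ≤ u v + c * (w - v) := by
  constructor
  · rintro ⟨d, hd, hdc⟩
    refine ⟨mem_volumeDomain_of_hasDerivWithinAt hv hd, fun w hw => ?_⟩
    have := hu.le_tangent hv (Or.inl (hv.trans_lt hw)) hd
    nlinarith [mul_le_mul_of_nonneg_right hdc (sub_nonneg.2 hw.le)]
  · rintro ⟨hdom, hsec⟩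
    have key : ∃ d, HasDerivWithinAt u d (Ici 0) v := by
      rcases hv.eq_or_lt with rfl | hv
      -- At volume 0 the secant slopes increase as w decreases to 0 and are bounded by c, so they
      -- converge and the right derivative exists.
      · have hanti : AntitoneOn (slope u 0) (Ioi 0) := by
          refine (hu.concaveOn.antitoneOn_slope_gt hdom).mono fun w hw => ?_
          exact ⟨Or.inl hw, hw⟩
        have hbdd : BddAbove (slope u 0 '' Ioi 0) := by
          refine ⟨c, ?_⟩
          rintro _ ⟨w, hw, rfl⟩
          have hw' : (0 : ℝ) < w := hw
          rw [slope_def_field, div_le_iff₀ (by linarith)]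
          linarith [hsec w hw]
        refine ⟨_, (hasDerivWithinAt_Ioi_iff_Ici).1
          ((hasDerivWithinAt_iff_tendsto_slope' self_notMem_Ioi).2
          (hanti.tendsto_nhdsGT hbdd))⟩
      · exact ⟨_, (hu.hasDerivAt hv).hasDerivWithinAt⟩
    obtain ⟨d, hd⟩ := key
    refine ⟨d, hd, ?_⟩
    have h1 : HasDerivWithinAt u d (Ioi v) v := hd.mono fun w hw => hv.trans (le_of_lt hw)
    refine le_of_tendsto ((hasDerivWithinAt_iff_tendsto_slope' self_notMem_Ioi).1 h1) ?_
    filter_upwards [self_mem_nhdsWithin] with w hw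
    have hw' : v < w := hw
    rw [slope_def_field, div_le_iff₀ (by linarith)]
    linarith [hsec w hw]

/-- In secant form the condition is a family of inequalities that pass to the limit. It makes the
set of event times closed, also at volume 0. -/
lemma isClosed_rightDeriv_le (hu : IsUtility u) :
    IsClosed {p : ℝ × ℝ | 0 ≤ p.1 ∧ ∃ d, HasDerivWithinAt u d (Ici 0) p.1 ∧ d ≤ p.2} := by
  refine IsSeqClosed.isClosed fun x p hx hp => ?_
  have h1 : Tendsto (fun n => (x n).1) atTop (𝓝 p.1) := (continuous_fst.tendsto p).comp hp
  have h2 : Tendsto (fun n => (x n).2) atTop (𝓝 p.2) := (continuous_snd.tendsto p).comp hp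
  have hp0 : 0 ≤ p.1 := ge_of_tendsto' h1 fun n => (hx n).1
  have hx' := fun n => (hu.exists_hasDerivWithinAt_le_iff (hx n).1).1 (hx n).2
  have hsec : ∀ w, p.1 < w → ∀ᶠ n in atTop, u w - (x n).2 * (w - (x n).1) ≤ u (x n).1 := by
    intro w hw
    filter_upwards [h1.eventually (gt_mem_nhds hw)] with n hn
    linarith [(hx' n).2 w hn]
  have hlim : ∀ w, Tendsto (fun n => u w - (x n).2 * (w - (x n).1)) atTop
      (𝓝 (u w - p.2 * (w - p.1))) := fun w =>
    tendsto_const_nhds.sub (h2.mul (tendsto_const_nhds.sub h1))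
  have hdom : p.1 ∈ volumeDomain u := by
    -- The secant to the fixed point `p.1 + 1` bounds the utilities along the sequence from below.
    refine hu.mem_volumeDomain_of_tendsto (B := u (p.1 + 1) - p.2 * (p.1 + 1 - p.1) - 1) h1
      (Eventually.of_forall fun n => (hx' n).1) ?_
    filter_upwards [hsec (p.1 + 1) (by linarith), (hlim (p.1 + 1)).eventually
      (lt_mem_nhds (sub_one_lt _))] with n hn hn'
    linarith
  refine ⟨hp0, (hu.exists_hasDerivWithinAt_le_iff hp0).2 ⟨hdom, fun w hw => ?_⟩⟩
  have h3 : Tendsto (fun n => u (x n).1) atTop (𝓝 (u p.1)) :=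
    (hu.continuousOn p.1 hdom).tendsto.comp
      (tendsto_nhdsWithin_iff.2 ⟨h1, Eventually.of_forall fun n => (hx' n).1⟩)
  linarith [le_of_tendsto_of_tendsto (hlim w) h3 (hsec w hw)]

end IsUtility

/-! ### Correctness of Bucket-filling -/

namespace BucketFilling

section Raise

variable {ι : Type*}

lemma raise_of_mem {s : State ι} {q : ι} (hq : q ∈ s.active) (θ : ℝ) :
    raise s θ q = s.y q + θ := by simp [raise, hq]

lemma raise_of_notMem {s : State ι} {q : ι} (hq : q ∉ s.active) (θ : ℝ) :
    raise s θ q = s.y q := by simp [raise, hq]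

lemma raise_zero (s : State ι) : raise s 0 = s.y := by
  ext q; simp [raise]

lemma continuous_raise (s : State ι) (q : ι) : Continuous fun θ => raise s θ q := by
  by_cases hq : q ∈ s.active
  · simp only [raise_of_mem hq]; fun_prop
  · simp only [raise_of_notMem hq]; fun_prop

lemma le_raise (s : State ι) {θ : ℝ} (hθ : 0 ≤ θ) (q : ι) : s.y q ≤ raise s θ q := by
  by_cases hq : q ∈ s.active
  · rw [raise_of_mem hq]; linarith
  · rw [raise_of_notMem hq]

end Raise

variable {ι : Type*} [Fintype ι]

/-- The loop invariant. The levels `a_q - ρ y_q` of the active buckets are equal, those of the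
full inactive buckets are at least as high, those of the pending buckets are at most as high, and
the gradient at the filled buckets is nonnegative. -/
structure Invariant (u : ℝ → ℝ) (ρ : ℝ) (N a : ι → ℝ) (s : State ι) : Prop where
  nonneg : ∀ q, 0 ≤ s.y q
  le : ∀ q, s.y q ≤ N q
  disj : ∀ q ∈ s.active, q ∉ s.pending
  pend : ∀ q ∈ s.pending, s.y q = 0
  full : ∀ q, q ∉ s.active → q ∉ s.pending → s.y q = N q
  active_level : ∀ p ∈ s.active, ∀ q ∈ s.active, a p - ρ * s.y p = a q - ρ * s.y q
  pending_level : ∀ p ∈ s.pending, ∀ q, q ∉ s.pending → a p ≤ a q - ρ * s.y q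
  full_level : ∀ p ∈ s.active, ∀ q, q ∉ s.active → q ∉ s.pending →
    a p - ρ * s.y p ≤ a q - ρ * s.y q
  grad : ∀ q, 0 < s.y q → ∀ d, HasDerivWithinAt u d (Ici 0) (∑ p, s.y p) →
    0 ≤ d + (a q - ρ * s.y q)

variable {u : ℝ → ℝ} {ρ : ℝ} {N a : ι → ℝ} {s : State ι}

/-! ### Invariance of the water levels under a pass -/

lemma mem_top {t : Finset ι} {q : ι} : q ∈ top a t ↔ q ∈ t ∧ ∀ p ∈ t, a p ≤ a q := by
  simp [top]

lemma top_nonempty {t : Finset ι} (ht : t.Nonempty) : (top a t).Nonempty := by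
  obtain ⟨q, hq, hmax⟩ := t.exists_max_image a ht
  exact ⟨q, mem_top.2 ⟨hq, hmax⟩⟩

lemma invariant_init (hN : ∀ q, 0 ≤ N q) : Invariant u ρ N a (init a) where
  nonneg q := le_rfl
  le q := hN q
  disj q hq := by simp_all [init]
  pend q _ := rfl
  full q h1 h2 := by simp_all [init]
  active_level p hp q hq := by
    have hp' := mem_top.1 hp
    have hq' := mem_top.1 hq
    have := le_antisymm (hq'.2 p hp'.1) (hp'.2 q hq'.1)
    simp [init, this]
  pending_level p hp q hq := by
    have hq' : q ∈ top a Finset.univ := by simpa [init] using hq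
    simpa [init] using (mem_top.1 hq').2 p (Finset.mem_univ p)
  full_level p hp q h1 h2 := by simp_all [init]
  grad q hq := absurd hq (lt_irrefl _)

lemma Invariant.activate (h : Invariant u ρ N a s) (hs : s.active = ∅) [DecidableEq ι] :
    Invariant u ρ N a ⟨s.y, top a s.pending, s.pending \ top a s.pending⟩ where
  nonneg := h.nonneg
  le := h.le
  disj q hq := by simp_all
  pend q hq := h.pend q (Finset.mem_sdiff.1 hq).1
  full q h1 h2 := by
    refine h.full q (by simp [hs]) fun hq => ?_
    simp_all
  active_level p hp q hq := by
    have hp' := mem_top.1 hp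
    have hq' := mem_top.1 hq
    have := le_antisymm (hq'.2 p hp'.1) (hp'.2 q hq'.1)
    simp [h.pend p hp'.1, h.pend q hq'.1, this]
  pending_level p hp q hq := by
    have hp' := (Finset.mem_sdiff.1 hp).1
    by_cases hqp : q ∈ s.pending
    · have hqt : q ∈ top a s.pending := by
        by_contra hqt
        exact hq (Finset.mem_sdiff.2 ⟨hqp, hqt⟩)
      simpa [h.pend q hqp] using (mem_top.1 hqt).2 p hp'
    · exact h.pending_level p hp' q hqp
  full_level p hp q h1 h2 := by
    have hp' := (mem_top.1 hp).1
    have hqp : q ∉ s.pending := fun hq => h2 (Finset.mem_sdiff.2 ⟨hq, h1⟩)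
    simpa [h.pend p hp'] using h.pending_level p hp' q hqp
  grad := h.grad

lemma isClosed_event (hu : IsUtility u) (h : ∀ q, 0 ≤ s.y q) :
    IsClosed {θ : ℝ | 0 ≤ θ ∧ Event u ρ N a s θ} := by
  have hA : IsClosed (⋃ q ∈ s.pending, ⋃ p ∈ s.active, {θ | a p - ρ * raise s θ p ≤ a q}) := by
    refine s.pending.finite_toSet.isClosed_biUnion fun q _ =>
      s.active.finite_toSet.isClosed_biUnion fun p _ => ?_
    exact isClosed_le (continuous_const.sub (continuous_const.mul (continuous_raise s p)))
      continuous_const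
  have hB : IsClosed (⋃ q ∈ s.active, {θ | raise s θ q = N q}) :=
    s.active.finite_toSet.isClosed_biUnion fun q _ =>
      isClosed_eq (continuous_raise s q) continuous_const
  have hC : IsClosed (⋂ q ∈ s.active,
      (fun θ => (∑ p, raise s θ p, ρ * raise s θ q - a q)) ⁻¹'
        {p : ℝ × ℝ | 0 ≤ p.1 ∧ ∃ d, HasDerivWithinAt u d (Ici 0) p.1 ∧ d ≤ p.2}) := by
    refine isClosed_biInter fun q _ => hu.isClosed_rightDeriv_le.preimage ?_
    exact (continuous_finsetSum _ fun p _ => continuous_raise s p).prodMk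
      ((continuous_const.mul (continuous_raise s q)).sub continuous_const)
  convert isClosed_Ici (a := (0 : ℝ)) |>.inter (hA.union (hB.union hC)) using 1
  ext θ
  simp only [mem_ofPred_eq, mem_inter_iff, mem_Ici, and_congr_right_iff]
  intro hθ
  have hsum : 0 ≤ ∑ p, raise s θ p :=
    Finset.sum_nonneg fun p _ => (h p).trans (le_raise s hθ p)
  simp [Event, Activates, GradNonpos, hsum]

/-- The infimum is attained because the event times form a closed set; it is nonempty since any
active bucket is full after an increase by N_q - y_q. -/
lemma increment_spec (hu : IsUtility u) (h : Invariant u ρ N a s) (hs : s.active.Nonempty) :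
    0 ≤ increment u ρ N a s ∧ Event u ρ N a s (increment u ρ N a s) := by
  obtain ⟨q, hq⟩ := hs
  refine (isClosed_event (N := N) (a := a) (ρ := ρ) hu h.nonneg).csInf_mem
    ⟨N q - s.y q, sub_nonneg.2 (h.le q), Or.inr (Or.inl ⟨q, hq, ?_⟩)⟩ ⟨0, fun θ hθ => hθ.1⟩
  rw [raise_of_mem hq]; ring

lemma not_event_of_lt_increment {θ : ℝ} (hθ : 0 ≤ θ) (hlt : θ < increment u ρ N a s) :
    ¬ Event u ρ N a s θ :=
  fun he => absurd hlt (not_lt.2 (csInf_le ⟨0, fun _ h => h.1⟩ ⟨hθ, he⟩))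

lemma raise_increment_le (h : Invariant u ρ N a s) (q : ι) :
    raise s (increment u ρ N a s) q ≤ N q := by
  by_cases hq : q ∈ s.active
  · by_contra! hlt
    rw [raise_of_mem hq] at hlt
    refine not_event_of_lt_increment (u := u) (ρ := ρ) (a := a) (sub_nonneg.2 (h.le q))
      (by linarith) (Or.inr (Or.inl ⟨q, hq, ?_⟩))
    rw [raise_of_mem hq]; ring
  · rw [raise_of_notMem hq]; exact h.le q

lemma le_level_raise_increment (hρ : 0 < ρ) (h : Invariant u ρ N a s) {p q : ι}
    (hp : p ∈ s.active) (hq : q ∈ s.pending) :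
    a q ≤ a p - ρ * raise s (increment u ρ N a s) p := by
  by_contra! hlt
  rw [raise_of_mem hp] at hlt
  have h0 := h.pending_level q hq p (h.disj p hp)
  have hθ : (a p - ρ * s.y p - a q) / ρ < increment u ρ N a s := by
    rw [div_lt_iff₀ hρ]; linarith
  refine not_event_of_lt_increment (div_nonneg (by linarith) hρ.le) hθ
    (Or.inl ⟨q, hq, p, hp, ?_⟩)
  rw [raise_of_mem hp, mul_add, mul_div_cancel₀ _ hρ.ne']
  linarith

lemma sum_raise_pos (h : ∀ q, 0 ≤ s.y q) {p : ι} (hp : p ∈ s.active) {θ : ℝ} (hθ : 0 < θ) :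
    0 < ∑ q, raise s θ q := by
  refine Finset.sum_pos' (fun q _ => (h q).trans (le_raise s hθ.le q)) ⟨p, Finset.mem_univ p, ?_⟩
  rw [raise_of_mem hp]
  linarith [h p]

/-- Strictly before the first event some active bucket has positive gradient. The active levels
agree, so every active gradient is positive there, and continuity of the derivative carries the sign
to the event itself. -/
lemma gradient_raise_increment (hu : IsUtility u) (h : Invariant u ρ N a s) {p : ι}
    (hp : p ∈ s.active) (hpos : 0 < increment u ρ N a s) :
    0 ≤ deriv u (∑ q, raise s (increment u ρ N a s) q)
      + (a p - ρ * raise s (increment u ρ N a s) p) := by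
  set θ := increment u ρ N a s with hθ
  have hcont : Continuous fun t => ∑ q, raise s t q :=
    continuous_finsetSum _ fun q _ => continuous_raise s q
  have h1 : Tendsto (fun t => deriv u (∑ q, raise s t q)) (𝓝[<] θ)
      (𝓝 (deriv u (∑ q, raise s θ q))) := by
    have h2 : ContinuousAt (deriv u) (∑ q, raise s θ q) :=
      hu.continuousOn_deriv.continuousAt (Ioi_mem_nhds (sum_raise_pos h.nonneg hp hpos))
    exact (h2.tendsto.comp (hcont.tendsto θ)).mono_left nhdsWithin_le_nhds
  have h3 : Tendsto (fun t => a p - ρ * raise s t p) (𝓝[<] θ) (𝓝 (a p - ρ * raise s θ p)) :=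
    ((continuous_const.sub (continuous_const.mul (continuous_raise s p))).tendsto θ).mono_left
      nhdsWithin_le_nhds
  refine ge_of_tendsto (h1.add h3) ?_
  filter_upwards [Ioo_mem_nhdsLT hpos] with t ht
  have hne := not_event_of_lt_increment ht.1.le ht.2
  have hg : ¬ ∀ q ∈ s.active, GradNonpos u ρ a (raise s t) q := fun hg => hne (Or.inr (Or.inr hg))
  push Not at hg
  obtain ⟨q, hq, hg⟩ := hg
  by_contra! hlt
  refine hg ⟨_, (hu.hasDerivAt (sum_raise_pos h.nonneg hp ht.1)).hasDerivWithinAt, ?_⟩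
  have := h.active_level p hp q hq
  rw [raise_of_mem hp] at hlt
  rw [raise_of_mem hq]
  linarith

/-- All active levels fall together to a common value. Newly activated buckets have exactly this
level, since the increase stops before the level falls below any pending one; full buckets keep
levels that were already at least as high. -/
lemma Invariant.raise [DecidableEq ι] (hu : IsUtility u) (hρ : 0 < ρ) (h : Invariant u ρ N a s)
    (hs : s.active.Nonempty) {new : Finset ι}
    (hnew : ∀ q, q ∈ new ↔ Activates ρ a s (raise s (increment u ρ N a s)) q)
    {act : Finset ι}
    (hact : ∀ q, q ∈ act ↔ q ∈ s.active ∧ BucketFilling.raise s (increment u ρ N a s) q ≠ N q) :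
    Invariant u ρ N a ⟨BucketFilling.raise s (increment u ρ N a s), act ∪ new,
      s.pending \ new⟩ := by
  have hinc := (increment_spec hu h hs).1
  have hle := raise_increment_le h
  have hlev := fun p hp q hq => le_level_raise_increment (p := p) (q := q) hρ h hp hq
  have hgrad := fun p hp => gradient_raise_increment (p := p) hu h hp
  have hsum := fun p hp => sum_raise_pos (s := s) (p := p)
    (θ := increment u ρ N a s) h.nonneg hp
  set θ := increment u ρ N a s
  obtain ⟨p₀, hp₀⟩ := hs
  have hpy : ∀ q ∈ s.pending, BucketFilling.raise s θ q = 0 := fun q hq => by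
    rw [raise_of_notMem (fun h' => h.disj q h' hq), h.pend q hq]
  have hactive : ∀ q ∈ s.active, a q - ρ * BucketFilling.raise s θ q
      = a p₀ - ρ * BucketFilling.raise s θ p₀ := fun q hq => by
    rw [raise_of_mem hq, raise_of_mem hp₀]
    linarith [h.active_level q hq p₀ hp₀]
  have hnew_level : ∀ q ∈ new, a q - ρ * BucketFilling.raise s θ q
      = a p₀ - ρ * BucketFilling.raise s θ p₀ := fun q hq => by
    obtain ⟨hqp, p, hp, hpq⟩ := (hnew q).1 hq
    have := hlev p₀ hp₀ q hqp
    rw [hactive p hp] at hpq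
    rw [hpy q hqp]; linarith
  have hact' : ∀ q ∈ act ∪ new, a q - ρ * BucketFilling.raise s θ q
      = a p₀ - ρ * BucketFilling.raise s θ p₀ := fun q hq => by
    rcases Finset.mem_union.1 hq with hq | hq
    · exact hactive q ((hact q).1 hq).1
    · exact hnew_level q hq
  have hge : ∀ q, q ∉ s.pending \ new → a p₀ - ρ * BucketFilling.raise s θ p₀
      ≤ a q - ρ * BucketFilling.raise s θ q := fun q hq => by
    by_cases hqa : q ∈ s.active
    · exact (hactive q hqa).ge
    by_cases hqn : q ∈ new
    · exact (hnew_level q hqn).ge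
    have hqp : q ∉ s.pending := fun hqp => hq (Finset.mem_sdiff.2 ⟨hqp, hqn⟩)
    have h1 := h.full_level p₀ hp₀ q hqa hqp
    have h2 := mul_le_mul_of_nonneg_left (le_raise s hinc p₀) hρ.le
    rw [raise_of_notMem hqa]
    linarith
  exact {
    nonneg := fun q => (h.nonneg q).trans (le_raise s hinc q)
    le := hle
    disj := fun q hq => by
      simp only [Finset.mem_union, hact] at hq
      simp only [Finset.mem_sdiff, not_and, not_not]
      intro hqp
      exact hq.resolve_left fun h' => h.disj q h'.1 hqp
    pend := fun q hq => hpy q (Finset.mem_sdiff.1 hq).1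
    full := fun q h1 h2 => by
      simp only [Finset.mem_union, hact, not_or, not_and, not_not] at h1
      by_cases hqa : q ∈ s.active
      · exact h1.1 hqa
      · exact (raise_of_notMem hqa θ).trans
          (h.full q hqa fun hqp => h2 (Finset.mem_sdiff.2 ⟨hqp, h1.2⟩))
    active_level := fun p hp q hq => (hact' p hp).trans (hact' q hq).symm
    pending_level := fun p hp q hq =>
      (hlev p₀ hp₀ p (Finset.mem_sdiff.1 hp).1).trans (hge q hq)
    full_level := fun p hp q _ h2 => (hact' p hp).le.trans (hge q h2)
    grad := fun q hq d hd => by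
      change 0 < BucketFilling.raise s θ q at hq
      change HasDerivWithinAt u d (Ici 0) (∑ p, BucketFilling.raise s θ p) at hd
      change 0 ≤ d + (a q - ρ * BucketFilling.raise s θ q)
      -- An increment of 0 leaves the vector unchanged, and the old gradient condition applies.
      -- Otherwise the volume is positive and the derivative is two-sided.
      rcases hinc.eq_or_lt with h0 | hpos
      · rw [← h0, raise_zero] at hd hq ⊢
        exact h.grad q hq d hd
      · have hv := hsum p₀ hp₀ hpos
        have hd' : d = deriv u (∑ p, BucketFilling.raise s θ p) :=
          (hd.hasDerivAt (Ici_mem_nhds hv)).unique (hu.hasDerivAt hv)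
        have hqp : q ∉ s.pending \ new := fun hqp =>
          hq.ne' (hpy q (Finset.mem_sdiff.1 hqp).1)
        have := hgrad p₀ hp₀ hpos
        rw [hd']
        linarith [hge q hqp] }

lemma Invariant.step (hu : IsUtility u) (hρ : 0 < ρ) (h : Invariant u ρ N a s) :
    Invariant u ρ N a (step u ρ N a s) := by
  classical
  unfold BucketFilling.step
  split_ifs with h1 h2
  · exact h
  · convert h.activate h2
  · convert h.raise hu hρ (Finset.nonempty_iff_ne_empty.2 h2) (fun q => ?_) (fun q => ?_)
    · simp only [Finset.mem_filter, and_iff_right_iff_imp]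
      exact fun hq => hq.1
    · simp

/-! ### Termination of Bucket-filling -/

/-- The number of passes that can still be needed. -/
def rank (s : State ι) : ℕ := 2 * s.pending.card + s.active.card

/-- An activation trades weight 2 for weight 1, and a bucket that fills up loses its weight 1. If
neither occurs, the event was the vanishing of the gradient with the active set unchanged, so the
new state is halted. -/
lemma step_halted_or_rank_lt (hu : IsUtility u) (h : Invariant u ρ N a s)
    (hs : ¬ Halted u ρ N a s) :
    Halted u ρ N a (step u ρ N a s) ∨ rank (step u ρ N a s) < rank s := by
  classical
  unfold BucketFilling.step
  rw [if_neg hs]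
  split_ifs with h2
  · right
    have hne : s.pending.Nonempty := by
      by_contra hne
      rw [Finset.not_nonempty_iff_eq_empty] at hne
      exact hs (Or.inr fun q => h.full q (by simp [h2]) (by simp [hne]))
    have hpos := (top_nonempty (a := a) hne).card_pos
    have hsub : top a s.pending ⊆ s.pending := fun q hq => (mem_top.1 hq).1
    have hc := Finset.card_sdiff_add_card_eq_card hsub
    simp only [rank, h2, Finset.card_empty]
    convert (show 2 * (s.pending \ top a s.pending).card + (top a s.pending).card
      < 2 * s.pending.card + 0 by omega)
  · have hne := Finset.nonempty_iff_ne_empty.2 h2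
    obtain ⟨-, hev⟩ := increment_spec hu h hne
    set θ := increment u ρ N a s
    set new : Finset ι := {q ∈ s.pending | Activates ρ a s (raise s θ) q} with hnew
    set act : Finset ι := {q ∈ s.active | raise s θ q ≠ N q} with hact
    have hsub : new ⊆ s.pending := Finset.filter_subset _ _
    have hsub' : act ⊆ s.active := Finset.filter_subset _ _
    have hc := Finset.card_sdiff_add_card_eq_card hsub
    have hu' := Finset.card_union_le act new
    have hcard := Finset.card_le_card hsub'
    have goal : Halted u ρ N a ⟨raise s θ, act ∪ new, s.pending \ new⟩ ∨
        rank ⟨raise s θ, act ∪ new, s.pending \ new⟩ < rank s := by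
      simp only [rank]
      by_cases hn : new.Nonempty
      · right
        have := hn.card_pos
        omega
      by_cases ha : ∃ q ∈ s.active, raise s θ q = N q
      · right
        obtain ⟨q, hq, hqN⟩ := ha
        have : act.card < s.active.card := Finset.card_lt_card
          ⟨hsub', fun hss => by simpa [hact, hqN] using hss hq⟩
        omega
      left
      rw [Finset.not_nonempty_iff_eq_empty] at hn
      have hae : act = s.active := Finset.filter_true_of_mem fun q hq hqN => ha ⟨q, hq, hqN⟩
      rcases hev with ⟨q, hq⟩ | hq | hg
      · have : q ∈ new := by rw [hnew, Finset.mem_filter]; exact ⟨hq.1, hq⟩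
        simp [hn] at this
      · exact absurd hq ha
      · rw [hae, hn, Finset.union_empty]
        exact Or.inl ⟨hne, hg⟩
    convert goal

lemma run_succ (n : ℕ) : run u ρ N a (n + 1) = step u ρ N a (run u ρ N a n) :=
  Function.iterate_succ_apply' _ _ _

lemma invariant_run (hu : IsUtility u) (hρ : 0 < ρ) (hN : ∀ q, 0 ≤ N q) (n : ℕ) :
    Invariant u ρ N a (run u ρ N a n) := by
  induction n with
  | zero => exact invariant_init hN
  | succ n ih => rw [run_succ]; exact ih.step hu hρ

lemma halted_run (hu : IsUtility u) (hρ : 0 < ρ) (hN : ∀ q, 0 ≤ N q) :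
    Halted u ρ N a (run u ρ N a (2 * Fintype.card ι)) := by
  classical
  have key : ∀ n, Halted u ρ N a (run u ρ N a n) ∨
      rank (run u ρ N a n) + n ≤ 2 * Fintype.card ι := by
    intro n
    induction n with
    | zero =>
      right
      have hsub : top a Finset.univ ⊆ (Finset.univ : Finset ι) := Finset.subset_univ _
      have hc := Finset.card_sdiff_add_card_eq_card hsub
      rw [Finset.card_univ] at hc
      have : 2 * (Finset.univ \ top a Finset.univ).card + (top a Finset.univ).card
        ≤ 2 * Fintype.card ι := by omega
      simp only [run, Function.iterate_zero, id, rank, init, add_zero]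
      convert this
    | succ n ih =>
      rw [run_succ]
      by_cases hh : Halted u ρ N a (run u ρ N a n)
      · left; rw [BucketFilling.step, if_pos hh]; exact hh
      · have ih' := ih.resolve_left hh
        refine (step_halted_or_rank_lt hu (invariant_run hu hρ hN n) hh).imp_right fun hlt => ?_
        omega
  refine (key _).elim id fun hr => ?_
  -- At rank 0 no bucket is active or pending, so all are full and the termination test succeeds
  -- anyway.
  have h0 : rank (run u ρ N a (2 * Fintype.card ι)) = 0 := by omega
  simp only [rank, Nat.add_eq_zero_iff, mul_eq_zero, Finset.card_eq_zero] at h0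
  refine Or.inr fun q => (invariant_run hu hρ hN _).full q ?_ ?_
  · simp [h0.2]
  · simp [h0.1.resolve_left (by norm_num)]

/-! ### Optimality of a halted state -/

lemma Invariant.sum_mem_volumeDomain (h : Invariant u ρ N a s) (hs : Halted u ρ N a s)
    (hfin : ContinuousWithinAt u (Ici 0) 0 ∨ ∃ q, 0 < N q) : ∑ q, s.y q ∈ volumeDomain u := by
  have h0 : 0 ≤ ∑ q, s.y q := Finset.sum_nonneg fun q _ => h.nonneg q
  rcases hs with ⟨⟨q, hq⟩, hg⟩ | hfull
  · obtain ⟨d, hd, -⟩ := hg q hq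
    exact IsUtility.mem_volumeDomain_of_hasDerivWithinAt h0 hd
  · rcases hfin with hc | ⟨q, hq⟩
    · exact mem_volumeDomain_of_continuous hc h0
    · exact Or.inl (Finset.sum_pos' (fun q _ => h.nonneg q) ⟨q, Finset.mem_univ q, by rwa [hfull]⟩)

/-- The tangent bound for u and the exact expansion of the quadratic reduce the claim to the KKT
inequalities. The term (ρ/2)|z - y|² is the strong concavity; it gives uniqueness here and the
three-point inequality of the inner loop later. -/
lemma Invariant.optimal (hu : IsUtility u) (h : Invariant u ρ N a s)
    (hs : Halted u ρ N a s) {z : ι → ℝ} (hz0 : ∀ q, 0 ≤ z q) (hzN : ∀ q, z q ≤ N q)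
    (hzd : ∑ q, z q ∈ volumeDomain u) :
    u (∑ q, z q) + ∑ q, (a q * z q - ρ / 2 * z q ^ 2) + ρ / 2 * ∑ q, (z q - s.y q) ^ 2
      ≤ u (∑ q, s.y q) + ∑ q, (a q * s.y q - ρ / 2 * s.y q ^ 2) := by
  have h0 : 0 ≤ ∑ q, s.y q := Finset.sum_nonneg fun q _ => h.nonneg q
  -- The second alternative covers a box reduced to {0}, where u may have no finite slope at volume
  -- 0.
  have kkt : (∃ d, HasDerivWithinAt u d (Ici 0) (∑ q, s.y q) ∧
      ∀ q, (z q - s.y q) * (d + (a q - ρ * s.y q)) ≤ 0) ∨ z = s.y := by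
    have upper : ∀ d, HasDerivWithinAt u d (Ici 0) (∑ q, s.y q) →
        (∀ q, s.y q < N q → d + (a q - ρ * s.y q) ≤ 0) →
        ∀ q, (z q - s.y q) * (d + (a q - ρ * s.y q)) ≤ 0 := by
      intro d hd hle q
      rcases le_total (z q) (s.y q) with hzy | hzy
      · rcases (h.nonneg q).eq_or_lt with hy | hy
        · have : z q = s.y q := le_antisymm hzy (hy ▸ hz0 q)
          simp [this]
        · exact mul_nonpos_of_nonpos_of_nonneg (by linarith) (h.grad q hy d hd)
      · rcases (h.le q).eq_or_lt with hy | hy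
        · have : z q = s.y q := le_antisymm (hy ▸ hzN q) hzy
          simp [this]
        · exact mul_nonpos_of_nonneg_of_nonpos (by linarith) (hle q hy)
    rcases hs with ⟨⟨p, hp⟩, hg⟩ | hfull
    · obtain ⟨d, hd, hdp⟩ := hg p hp
      refine Or.inl ⟨d, hd, upper d hd fun q hq => ?_⟩
      by_cases hqa : q ∈ s.active
      · linarith [h.active_level p hp q hqa]
      by_cases hqp : q ∈ s.pending
      · have := h.pending_level q hqp p (h.disj p hp)
        rw [h.pend q hqp]; linarith
      · exact absurd (h.full q hqa hqp) hq.ne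
    · rcases h0.eq_or_lt with hv | hv
      · right
        have hy := (Finset.sum_eq_zero_iff_of_nonneg fun q _ => h.nonneg q).1 hv.symm
        ext q
        have h1 := hy q (Finset.mem_univ q)
        exact le_antisymm (hfull q ▸ hzN q) (h1 ▸ hz0 q)
      · exact Or.inl ⟨_, (hu.hasDerivAt hv).hasDerivWithinAt,
          upper _ (hu.hasDerivAt hv).hasDerivWithinAt fun q hq => absurd (hfull q) hq.ne⟩
  rcases kkt with ⟨d, hd, hk⟩ | rfl
  · have h1 := hu.le_tangent h0 hzd hd
    have h2 : ∑ q, (a q * z q - ρ / 2 * z q ^ 2) + ρ / 2 * ∑ q, (z q - s.y q) ^ 2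
        + d * (∑ q, z q - ∑ q, s.y q) ≤ ∑ q, (a q * s.y q - ρ / 2 * s.y q ^ 2) := by
      rw [Finset.mul_sum, ← Finset.sum_sub_distrib, Finset.mul_sum, ← Finset.sum_add_distrib,
        ← Finset.sum_add_distrib]
      refine Finset.sum_le_sum fun q _ => ?_
      linarith [hk q]
    linarith
  · simp

end BucketFilling

/-! ### Linear and convex structure of the routing problem -/

namespace CacheNetwork

variable {M S F : Type*} [Fintype M] [DecidableEq M] [Fintype S] [Fintype F] [DecidableEq F]
variable (G : CacheNetwork M S F)

/-- The requests `N_q - ∑_m y_{m,q}` that `y` leaves unserved. -/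
def residual (N : G.RegionFile → ℝ) (y : G.Routing) (q : G.RegionFile) : ℝ := N q - G.routed y q

/-- The squared Euclidean norm of a routing vector. -/
def normSq (y : G.Routing) : ℝ := ∑ m, ∑ q, y m q ^ 2

/-- The results of Bucket-filling at all stations. -/
noncomputable def jacobi (N : G.RegionFile → ℝ) (U : M → ℝ → ℝ) (ρ : ℝ)
    (lam : G.Prices) (y : G.Routing) : G.Routing := fun m => G.stationSolve N U ρ lam y m

variable {G} {N : G.RegionFile → ℝ} {U : M → ℝ → ℝ} {ρ α : ℝ} {lam : G.Prices}

lemma sum_served_eq_sum_stationsOf (f : (m : M) → G.Served m → ℝ) :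
    ∑ m, ∑ q, f m q = ∑ q, ∑ m : G.StationsOf q, f m.1 ⟨q, m.2⟩ := by
  let e : (Σ m, G.Served m) ≃ Σ q, G.StationsOf q :=
    { toFun := fun x => ⟨x.2.1, ⟨x.1, x.2.2⟩⟩
      invFun := fun x => ⟨x.2.1, ⟨x.1, x.2.2⟩⟩
      left_inv := fun _ => rfl
      right_inv := fun _ => rfl }
  have h1 := Fintype.sum_sigma (fun x : Σ m, G.Served m => f x.1 x.2)
  have h2 := Fintype.sum_sigma (fun x : Σ q, G.StationsOf q => f x.2.1 ⟨x.1, x.2.2⟩)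
  rw [← h1, ← h2]
  exact Fintype.sum_equiv e _ _ fun _ => rfl

lemma sum_mul_eq_sum_mul_routed (c : G.Prices) (y : G.Routing) :
    ∑ m, ∑ q : G.Served m, c q.1 * y m q = ∑ q, c q * G.routed y q := by
  rw [sum_served_eq_sum_stationsOf (fun m q => c q.1 * y m q)]
  exact Finset.sum_congr rfl fun q _ => by rw [routed, Finset.mul_sum]

@[simp] lemma routed_add (y z : G.Routing) (q : G.RegionFile) :
    G.routed (y + z) q = G.routed y q + G.routed z q := by
  simp [routed, Finset.sum_add_distrib]

@[simp] lemma routed_sub (y z : G.Routing) (q : G.RegionFile) :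
    G.routed (y - z) q = G.routed y q - G.routed z q := by
  simp [routed, Finset.sum_sub_distrib]

@[simp] lemma routed_smul (t : ℝ) (y : G.Routing) (q : G.RegionFile) :
    G.routed (t • y) q = t * G.routed y q := by
  simp [routed, Finset.mul_sum]

@[simp] lemma volume_add {m : M} (y z : G.Served m → ℝ) :
    G.volume (y + z) = G.volume y + G.volume z := by
  simp [volume, Finset.sum_add_distrib]

@[simp] lemma volume_sub {m : M} (y z : G.Served m → ℝ) :
    G.volume (y - z) = G.volume y - G.volume z := by
  simp [volume, Finset.sum_sub_distrib]

@[simp] lemma volume_smul {m : M} (t : ℝ) (y : G.Served m → ℝ) :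
    G.volume (t • y) = t * G.volume y := by
  simp [volume, Finset.mul_sum]

lemma continuous_routed (q : G.RegionFile) : Continuous fun y : G.Routing => G.routed y q := by
  unfold routed; fun_prop

lemma continuous_residual (q : G.RegionFile) : Continuous fun y : G.Routing => G.residual N y q :=
  continuous_const.sub (continuous_routed q)

lemma continuous_volume (m : M) : Continuous fun y : G.Routing => G.volume (y m) := by
  unfold volume; fun_prop

lemma continuous_normSq : Continuous fun y : G.Routing => G.normSq y := by
  unfold normSq; fun_prop

lemma normSq_nonneg (y : G.Routing) : 0 ≤ G.normSq y :=
  Finset.sum_nonneg fun _ _ => Finset.sum_nonneg fun _ _ => sq_nonneg _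

lemma sq_le_normSq (y : G.Routing) (m : M) (q : G.Served m) : y m q ^ 2 ≤ G.normSq y := by
  refine (Finset.single_le_sum (f := fun q => y m q ^ 2) (fun _ _ => sq_nonneg _)
    (Finset.mem_univ q)).trans ?_
  exact Finset.single_le_sum (f := fun m => ∑ q, y m q ^ 2)
    (fun _ _ => Finset.sum_nonneg fun _ _ => sq_nonneg _) (Finset.mem_univ m)

lemma residual_add_smul_sub (y z : G.Routing) (t : ℝ) (q : G.RegionFile) :
    G.residual N (y + t • (z - y)) q = G.residual N y q - t * G.routed (z - y) q := by
  simp [residual]; ring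

/-- Cauchy–Schwarz over the stations of each region-file. This is the only coupling between
stations, and the place where the bound on α times their number enters. -/
lemma sum_routed_sq_le {β : ℝ} (hα0 : 0 ≤ α)
    (hβ : ∀ q, α * ((G.stations q).card : ℝ) ≤ β) (y : G.Routing) :
    α * ∑ q, G.routed y q ^ 2 ≤ β * G.normSq y := by
  rw [normSq, sum_served_eq_sum_stationsOf (fun m q => y m q ^ 2), Finset.mul_sum, Finset.mul_sum]
  refine Finset.sum_le_sum fun q _ => ?_
  have h1 := sq_sum_le_card_mul_sum_sq (s := (Finset.univ : Finset (G.StationsOf q)))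
    (f := fun m => y m.1 ⟨q, m.2⟩)
  rw [Finset.card_univ, Fintype.card_coe] at h1
  have h2 : 0 ≤ ∑ m : G.StationsOf q, y m.1 ⟨q, m.2⟩ ^ 2 :=
    Finset.sum_nonneg fun _ _ => sq_nonneg _
  calc α * G.routed y q ^ 2
      ≤ α * ((G.stations q).card * ∑ m : G.StationsOf q, y m.1 ⟨q, m.2⟩ ^ 2) :=
        mul_le_mul_of_nonneg_left h1 hα0
    _ = α * (G.stations q).card * ∑ m : G.StationsOf q, y m.1 ⟨q, m.2⟩ ^ 2 := by ring
    _ ≤ _ := mul_le_mul_of_nonneg_right (hβ q) h2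

/-- With this form a_q - ρ y_{m,q} = λ_q + ρ r_q(y) at the current vector, which is the derivative
in y_{m,q} of the price and penalty terms of L. -/
lemma leftover_eq (y : G.Routing) (m : M) (q : G.Served m) :
    G.leftover N y m q = G.residual N y q.1 + y m q := by
  have h : ∑ m' : G.StationsOf q.1, (if m'.1 = m then 0 else y m'.1 ⟨q.1, m'.2⟩)
      + y m q = G.routed y q.1 := by
    have h1 : y m q = ∑ m' : G.StationsOf q.1,
        if m' = ⟨m, q.2⟩ then y m'.1 ⟨q.1, m'.2⟩ else 0 := by
      rw [Finset.sum_ite_eq' Finset.univ (⟨m, q.2⟩ : G.StationsOf q.1)]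
      simp
    rw [h1, ← Finset.sum_add_distrib, routed]
    refine Finset.sum_congr rfl fun m' _ => ?_
    by_cases hm : m'.1 = m
    · have : m' = ⟨m, q.2⟩ := Subtype.ext hm
      simp [this]
    · have : m' ≠ ⟨m, q.2⟩ := fun h => hm (congrArg Subtype.val h)
      simp [hm, this]
  rw [leftover, residual]
  linarith

lemma augLagrangian_eq (y : G.Routing) : G.augLagrangian N U ρ lam y = G.totalUtility U y
    - ∑ q, lam q * G.residual N y q - ρ / 2 * ∑ q, G.residual N y q ^ 2 := rfl

/-! ### The box, the primal domain and concavity -/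

lemma box_eq_Icc : G.box N = Icc 0 (fun _ q => N q.1) := by
  ext y
  simp only [box, mem_ofPred_eq, mem_Icc, Pi.le_def]
  exact ⟨fun h => ⟨fun m q => (h m q).1, fun m q => (h m q).2⟩,
    fun h m q => ⟨h.1 m q, h.2 m q⟩⟩

lemma isCompact_box : IsCompact (G.box N) := by
  rw [box_eq_Icc]; exact isCompact_Icc

lemma volume_nonneg {y : G.Routing} (hy : y ∈ G.box N) (m : M) : 0 ≤ G.volume (y m) :=
  Finset.sum_nonneg fun q _ => (hy m q).1

lemma volume_le {y : G.Routing} (hy : y ∈ G.box N) (m : M) :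
    G.volume (y m) ≤ ∑ q : G.Served m, N q.1 :=
  Finset.sum_le_sum fun q _ => (hy m q).2

lemma combo_mem_box {y z : G.Routing} (hy : y ∈ G.box N) (hz : z ∈ G.box N) {t : ℝ}
    (ht : 0 ≤ t) (ht1 : t ≤ 1) : y + t • (z - y) ∈ G.box N := by
  intro m q
  have h1 := hy m q
  have h2 := hz m q
  simp only [Pi.add_apply, Pi.smul_apply, Pi.sub_apply, smul_eq_mul]
  constructor <;> nlinarith

lemma combo_mem_primalDomain {y z : G.Routing} (hy : y ∈ G.box N) (hz : z ∈ G.primalDomain N U)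
    {t : ℝ} (ht : 0 < t) (ht1 : t ≤ 1) : y + t • (z - y) ∈ G.primalDomain N U := by
  refine ⟨combo_mem_box hy hz.1 ht.le ht1, fun m => ?_⟩
  have := combo_mem_volumeDomain (volume_nonneg hy m) (hz.2 m) ht ht1
  simpa using this

lemma totalUtility_combo (hU : ∀ m, IsUtility (U m)) {y z : G.Routing}
    (hy : y ∈ G.primalDomain N U) (hz : z ∈ G.primalDomain N U) {t : ℝ}
    (ht : 0 ≤ t) (ht1 : t ≤ 1) :
    (1 - t) * G.totalUtility U y + t * G.totalUtility U z
      ≤ G.totalUtility U (y + t • (z - y)) := by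
  simp only [totalUtility, Finset.mul_sum]
  rw [← Finset.sum_add_distrib]
  refine Finset.sum_le_sum fun m _ => ?_
  have := (hU m).concaveOn.2 (hy.2 m) (hz.2 m) (sub_nonneg.2 ht1) ht (by ring)
  simp only [smul_eq_mul] at this
  refine this.trans_eq (congrArg (U m) ?_)
  simp only [Pi.add_apply, Pi.smul_apply, Pi.sub_apply, volume_add, volume_smul, volume_sub]
  ring

lemma continuousOn_totalUtility (hU : ∀ m, IsUtility (U m)) :
    ContinuousOn (G.totalUtility U) (G.primalDomain N U) :=
  continuousOn_finsetSum _ fun m _ =>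
    (hU m).continuousOn.comp (continuous_volume m).continuousOn fun _ hy => hy.2 m

/-! ### Compactness and existence of maximizers -/

lemma utility_le (hU : ∀ m, IsUtility (U m)) {y : G.Routing} (hy : y ∈ G.primalDomain N U)
    (m : M) : U m (G.volume (y m)) ≤ U m (∑ q : G.Served m, N q.1) :=
  (hU m).monotoneOn (hy.2 m) (mem_volumeDomain_of_le (hy.2 m) (volume_le hy.1 m))
    (volume_le hy.1 m)

lemma mem_primalDomain_of_tendsto (hU : ∀ m, IsUtility (U m)) {x : ℕ → G.Routing} {y : G.Routing}
    (hx : Tendsto x atTop (𝓝 y)) (hd : ∀ n, x n ∈ G.primalDomain N U) {B : ℝ}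
    (hB : ∀ᶠ n in atTop, B ≤ G.totalUtility U (x n)) : y ∈ G.primalDomain N U := by
  refine ⟨isCompact_box.isClosed.mem_of_tendsto hx (Eventually.of_forall fun n => (hd n).1),
    fun m => ?_⟩
  refine (hU m).mem_volumeDomain_of_tendsto
    -- Every other utility is at most its value at the largest possible volume, so a lower bound on
    -- the sum bounds each summand from below.
    (B := B - ∑ k ∈ Finset.univ.erase m, U k (∑ q : G.Served k, N q.1))
    (((continuous_volume m).tendsto y).comp hx) (Eventually.of_forall fun n => (hd n).2 m) ?_
  filter_upwards [hB] with n hn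
  have h1 := Finset.add_sum_erase Finset.univ (fun k => U k (G.volume (x n k))) (Finset.mem_univ m)
  have h2 := Finset.sum_le_sum (s := Finset.univ.erase m) fun k _ => utility_le hU (hd n) k
  simp only [totalUtility] at hn
  simp only [Function.comp]
  linarith

lemma tendsto_totalUtility (hU : ∀ m, IsUtility (U m)) {x : ℕ → G.Routing} {y : G.Routing}
    (hx : Tendsto x atTop (𝓝 y)) (hd : ∀ n, x n ∈ G.primalDomain N U)
    (hy : y ∈ G.primalDomain N U) :
    Tendsto (fun n => G.totalUtility U (x n)) atTop (𝓝 (G.totalUtility U y)) :=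
  (continuousOn_totalUtility hU y hy).tendsto.comp
    (tendsto_nhdsWithin_iff.2 ⟨hx, Eventually.of_forall hd⟩)

lemma isCompact_superlevel (hU : ∀ m, IsUtility (U m)) (B : ℝ) :
    IsCompact {y | y ∈ G.primalDomain N U ∧ B ≤ G.totalUtility U y} := by
  refine isCompact_box.of_isClosed_subset (IsSeqClosed.isClosed fun x y hx hy => ?_)
    fun y hy => hy.1.1
  have hd := mem_primalDomain_of_tendsto hU hy (fun n => (hx n).1)
    (Eventually.of_forall fun n => (hx n).2)
  exact ⟨hd, ge_of_tendsto' (tendsto_totalUtility hU hy (fun n => (hx n).1) hd) fun n => (hx n).2⟩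

lemma stations_nonempty (q : G.RegionFile) : (G.stations q).Nonempty := by
  obtain ⟨m, hm, hf⟩ := q.2
  exact ⟨m, by simp [stations, hm, hf]⟩

/-- Splitting each request equally among its stations gives positive volume to every station with a
positive request. -/
lemma crpFeasible_nonempty (hN : ∀ q, 0 ≤ N q)
    (hfin : ∀ m, ContinuousWithinAt (U m) (Ici 0) 0 ∨ ∃ q : G.Served m, 0 < N q.1) :
    (G.crpFeasible N U).Nonempty := by
  have hpos : ∀ q, (0 : ℝ) < (G.stations q).card := fun q =>
    Nat.cast_pos.2 (stations_nonempty q).card_pos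
  have hbox : (fun _ q => N q.1 / (G.stations q.1).card : G.Routing) ∈ G.box N := fun m q => by
    refine ⟨div_nonneg (hN _) (hpos _).le, div_le_self (hN _) ?_⟩
    exact_mod_cast (stations_nonempty q.1).card_pos
  refine ⟨fun m q => N q.1 / (G.stations q.1).card, ⟨hbox, fun m => ?_⟩, fun q => ?_⟩
  · rcases hfin m with hc | ⟨q, hq⟩
    · exact mem_volumeDomain_of_continuous hc (volume_nonneg hbox m)
    · exact Or.inl (Finset.sum_pos' (fun q _ => (hbox m q).1)
        ⟨q, Finset.mem_univ q, div_pos hq (hpos _)⟩)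
  · simp only [routed, Finset.sum_const, Finset.card_univ, Fintype.card_coe, nsmul_eq_mul]
    exact mul_div_cancel₀ _ (hpos q).ne'

lemma crpOptima_nonempty (hU : ∀ m, IsUtility (U m)) (hN : ∀ q, 0 ≤ N q)
    (hfin : ∀ m, ContinuousWithinAt (U m) (Ici 0) 0 ∨ ∃ q : G.Served m, 0 < N q.1) :
    (G.crpOptima N U).Nonempty := by
  obtain ⟨w, hw⟩ := crpFeasible_nonempty hN hfin
  have hclosed : IsClosed {y : G.Routing | ∀ q, G.routed y q = N q} := by
    simp only [Set.ofPred_forall]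
    exact isClosed_iInter fun q => isClosed_eq (continuous_routed q) continuous_const
  have hK := (isCompact_superlevel (N := N) hU (G.totalUtility U w)).inter_right hclosed
  obtain ⟨y, hy, hmax⟩ := hK.exists_isMaxOn ⟨w, ⟨hw.1, le_rfl⟩, hw.2⟩
    ((continuousOn_totalUtility hU).mono fun y hy => hy.1.1)
  refine ⟨y, ⟨hy.1.1, hy.2⟩, fun z hz => ?_⟩
  rcases le_total (G.totalUtility U w) (G.totalUtility U z) with h | h
  · exact hmax ⟨⟨hz.1, h⟩, hz.2⟩
  · exact h.trans hy.1.2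

lemma exists_isMaxOn_augLagrangian (hU : ∀ m, IsUtility (U m)) (ρ : ℝ) (lam : G.Prices)
    (hne : (G.primalDomain N U).Nonempty) :
    ∃ y ∈ G.primalDomain N U, IsMaxOn (G.augLagrangian N U ρ lam) (G.primalDomain N U) y := by
  obtain ⟨w, hw⟩ := hne
  have hcont : Continuous fun y => - ∑ q, lam q * G.residual N y q
      - ρ / 2 * ∑ q, G.residual N y q ^ 2 := by
    have := fun q => continuous_residual (N := N) q
    fun_prop
  obtain ⟨b, -, hb⟩ := isCompact_box.exists_isMaxOn ⟨w, hw.1⟩ hcont.continuousOn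
  set C := - ∑ q, lam q * G.residual N b q - ρ / 2 * ∑ q, G.residual N b q ^ 2
  -- The price and penalty terms are bounded on the box, so superlevel sets of L lie in the compact
  -- superlevel sets of the total utility.
  have hC : ∀ y ∈ G.primalDomain N U, G.augLagrangian N U ρ lam y ≤ G.totalUtility U y + C := by
    intro y hy
    have : - ∑ q, lam q * G.residual N y q - ρ / 2 * ∑ q, G.residual N y q ^ 2 ≤ C := hb hy.1
    rw [augLagrangian_eq]; linarith
  have hcontL : ContinuousOn (G.augLagrangian N U ρ lam) (G.primalDomain N U) := by
    refine ((continuousOn_totalUtility hU).add hcont.continuousOn).congr fun y _ => ?_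
    rw [augLagrangian_eq, Pi.add_apply]; ring
  obtain ⟨y, hy, hmax⟩ := (isCompact_superlevel (N := N) hU
    (G.augLagrangian N U ρ lam w - C)).exists_isMaxOn ⟨w, hw, by linarith [hC w hw]⟩
    (hcontL.mono fun y hy => hy.1)
  refine ⟨y, hy.1, fun z hz => ?_⟩
  rcases le_total (G.augLagrangian N U ρ lam w) (G.augLagrangian N U ρ lam z) with h | h
  · exact hmax ⟨hz, by linarith [hC z hz]⟩
  · exact h.trans (hmax ⟨hw, by linarith [hC w hw]⟩)

/-- Otherwise points with defects 1/(n+1) stay at distance at least η from the optima; by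
compactness a subsequence converges, and its limit is feasible and optimal. -/
lemma infDist_crpOptima_lt (hU : ∀ m, IsUtility (U m)) {yOpt : G.Routing}
    (hopt : yOpt ∈ G.crpOptima N U) {η : ℝ} (hη : 0 < η) :
    ∃ κ > 0, ∀ y ∈ G.primalDomain N U, G.totalUtility U yOpt - κ ≤ G.totalUtility U y →
      (∀ q, |G.residual N y q| ≤ κ) → Metric.infDist y (G.crpOptima N U) < η := by
  by_contra! hcon
  have hpos : ∀ n : ℕ, (0 : ℝ) < 1 / ((n : ℝ) + 1) := fun n => Nat.one_div_pos_of_nat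
  choose x hxd hxF hxr hxη using fun n : ℕ => hcon _ (hpos n)
  have hlim := tendsto_one_div_add_atTop_nhds_zero_nat (𝕜 := ℝ)
  have hle : ∀ n : ℕ, 1 / ((n : ℝ) + 1) ≤ 1 := fun n => by
    rw [div_le_one (by positivity)]; linarith [n.cast_nonneg (α := ℝ)]
  obtain ⟨y, hy, φ, hφ, hφy⟩ := (isCompact_superlevel (N := N) hU
    (G.totalUtility U yOpt - 1)).tendsto_subseq (x := x)
    fun n => ⟨hxd n, by linarith [hxF n, hle n]⟩
  have hlim' := hlim.comp hφ.tendsto_atTop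
  have hF : G.totalUtility U yOpt ≤ G.totalUtility U y := by
    have h1 := tendsto_totalUtility hU hφy (fun n => hxd _) hy.1
    have h2 := tendsto_const_nhds (x := G.totalUtility U yOpt).sub hlim'
    rw [sub_zero] at h2
    exact le_of_tendsto_of_tendsto' h2 h1 fun n => hxF _
  have hr : ∀ q, G.routed y q = N q := by
    intro q
    have h1 := (((continuous_residual (N := N) q).tendsto y).comp hφy).abs
    have h2 : |G.residual N y q| ≤ 0 := le_of_tendsto_of_tendsto' h1 hlim' fun n => hxr _ q
    have := abs_nonpos_iff.1 h2
    rw [residual] at this; linarith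
  have hyopt : y ∈ G.crpOptima N U := ⟨⟨hy.1, hr⟩, fun z hz => (hopt.2 hz).trans hF⟩
  have h3 : Tendsto (fun n => dist (x (φ n)) y) atTop (𝓝 0) := tendsto_iff_dist_tendsto_zero.1 hφy
  obtain ⟨n, hn⟩ := (h3.eventually (gt_mem_nhds hη)).exists
  exact absurd ((Metric.infDist_le_dist_of_mem hyopt).trans_lt hn) (not_lt.2 (hxη _))

end CacheNetwork

/-! ### The inner loop -/

namespace CacheNetwork

variable {M S F : Type*} [Fintype M] [DecidableEq M] [Fintype S] [Fintype F] [DecidableEq F]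
variable {G : CacheNetwork M S F} {N : G.RegionFile → ℝ} {U : M → ℝ → ℝ} {ρ α β : ℝ}
  {lam : G.Prices}

lemma halted_station (hU : ∀ m, IsUtility (U m)) (hN : ∀ q, 0 ≤ N q) (hρ : 0 < ρ)
    (lam : G.Prices) (y : G.Routing) (m : M) :
    BucketFilling.Halted (U m) ρ (fun q => N q.1) (G.bucketCoeff N ρ lam y m)
      (BucketFilling.run (U m) ρ (fun q => N q.1) (G.bucketCoeff N ρ lam y m)
        (2 * Fintype.card (G.Served m))) :=
  BucketFilling.halted_run (hU m) hρ fun q => hN q.1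

lemma stationSolve_mem (hU : ∀ m, IsUtility (U m)) (hN : ∀ q, 0 ≤ N q) (hρ : 0 < ρ)
    (hfin : ∀ m, ContinuousWithinAt (U m) (Ici 0) 0 ∨ ∃ q : G.Served m, 0 < N q.1)
    (lam : G.Prices) (y : G.Routing) (m : M) :
    G.stationSolve N U ρ lam y m ∈ G.stationDomain N (U m) m := by
  have h := BucketFilling.invariant_run (a := G.bucketCoeff N ρ lam y m) (hU m) hρ
    (fun q => hN q.1) (2 * Fintype.card (G.Served m))
  exact ⟨fun q => ⟨h.nonneg q, h.le q⟩,
    h.sum_mem_volumeDomain (halted_station hU hN hρ lam y m) (hfin m)⟩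

lemma station_strong_max (hU : ∀ m, IsUtility (U m)) (hN : ∀ q, 0 ≤ N q) (hρ : 0 < ρ)
    (lam : G.Prices) (y : G.Routing) (m : M) {z : G.Served m → ℝ}
    (hz : z ∈ G.stationDomain N (U m) m) :
    U m (G.volume z) + ∑ q, (G.bucketCoeff N ρ lam y m q * z q - ρ / 2 * z q ^ 2)
        + ρ / 2 * ∑ q, (z q - G.stationSolve N U ρ lam y m q) ^ 2
      ≤ U m (G.volume (G.stationSolve N U ρ lam y m))
        + ∑ q, (G.bucketCoeff N ρ lam y m q * G.stationSolve N U ρ lam y m q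
          - ρ / 2 * G.stationSolve N U ρ lam y m q ^ 2) := by
  have h := BucketFilling.invariant_run (a := G.bucketCoeff N ρ lam y m) (hU m) hρ
    (fun q => hN q.1) (2 * Fintype.card (G.Served m))
  have hh := halted_station hU hN hρ lam y m
  have ho := h.optimal (hU m) hh (fun q => (hz.1 q).1) (fun q => (hz.1 q).2) hz.2
  simp only [stationSolve, BucketFilling.output, volume]
  exact ho

lemma stationObjective_eq (y : G.Routing) (m : M) (z : G.Served m → ℝ) :
    G.stationObjective N U ρ lam y m z = U m (G.volume z)
      + ∑ q, (G.bucketCoeff N ρ lam y m q * z q - ρ / 2 * z q ^ 2)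
      - ρ / 2 * ∑ q, G.leftover N y m q ^ 2 := by
  rw [stationObjective, add_sub_assoc, add_sub_assoc]
  congr 1
  rw [Finset.mul_sum, Finset.mul_sum, ← Finset.sum_sub_distrib, ← Finset.sum_sub_distrib]
  refine Finset.sum_congr rfl fun q _ => ?_
  rw [bucketCoeff]; ring

lemma stationObjective_lt (hU : ∀ m, IsUtility (U m)) (hN : ∀ q, 0 ≤ N q) (hρ : 0 < ρ)
    (lam : G.Prices) (y : G.Routing) (m : M) {z : G.Served m → ℝ}
    (hz : z ∈ G.stationDomain N (U m) m) (hne : z ≠ G.stationSolve N U ρ lam y m) :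
    G.stationObjective N U ρ lam y m z
      < G.stationObjective N U ρ lam y m (G.stationSolve N U ρ lam y m) := by
  have h1 := station_strong_max hU hN hρ lam y m hz
  have h2 : 0 < ∑ q, (z q - G.stationSolve N U ρ lam y m q) ^ 2 := by
    obtain ⟨q, hq⟩ := Function.ne_iff.1 hne
    exact Finset.sum_pos' (fun _ _ => sq_nonneg _)
      ⟨q, Finset.mem_univ q, sq_pos_iff.2 (sub_ne_zero.2 hq)⟩
  rw [stationObjective_eq, stationObjective_eq]
  have h3 := mul_pos (half_pos hρ) h2
  linarith

lemma jacobi_mem (hU : ∀ m, IsUtility (U m)) (hN : ∀ q, 0 ≤ N q) (hρ : 0 < ρ)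
    (hfin : ∀ m, ContinuousWithinAt (U m) (Ici 0) 0 ∨ ∃ q : G.Served m, 0 < N q.1)
    (lam : G.Prices) (y : G.Routing) : G.jacobi N U ρ lam y ∈ G.primalDomain N U :=
  ⟨fun m q => (stationSolve_mem hU hN hρ hfin lam y m).1 q,
    fun m => (stationSolve_mem hU hN hρ hfin lam y m).2⟩

/-- The strong maximality at the stations, summed over m. After substituting `leftover_eq`, the
quadratics combine into the linearization of the price and penalty terms at y minus the proximal
term (ρ/2)|w - y|². -/
lemma jacobi_variational (hU : ∀ m, IsUtility (U m)) (hN : ∀ q, 0 ≤ N q) (hρ : 0 < ρ)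
    (lam : G.Prices) (y : G.Routing) {w : G.Routing} (hw : w ∈ G.primalDomain N U) :
    G.totalUtility U w
      + ∑ q, (lam q + ρ * G.residual N y q) * G.routed (w - G.jacobi N U ρ lam y) q
      - ρ / 2 * G.normSq (w - y) + ρ / 2 * G.normSq (w - G.jacobi N U ρ lam y)
      + ρ / 2 * G.normSq (G.jacobi N U ρ lam y - y) ≤ G.totalUtility U (G.jacobi N U ρ lam y) := by
  set z := G.jacobi N U ρ lam y
  have h := Finset.sum_le_sum (s := Finset.univ) fun m _ =>
    station_strong_max hU hN hρ lam y m (z := w m) ⟨hw.1 m, hw.2 m⟩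
  simp only [Finset.sum_add_distrib] at h
  change G.totalUtility U w + _ + _ ≤ G.totalUtility U z +
    ∑ m, ∑ q, (G.bucketCoeff N ρ lam y m q * z m q - ρ / 2 * z m q ^ 2) at h
  have h2 : ∑ m, ∑ q : G.Served m, (lam q.1 + ρ * G.residual N y q.1) * (w - z) m q
      - ρ / 2 * G.normSq (w - y) + ρ / 2 * G.normSq (z - y)
      = ∑ m, ∑ q, (G.bucketCoeff N ρ lam y m q * w m q - ρ / 2 * w m q ^ 2)
      - ∑ m, ∑ q, (G.bucketCoeff N ρ lam y m q * z m q - ρ / 2 * z m q ^ 2) := by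
    simp only [normSq, Finset.mul_sum]
    simp only [← Finset.sum_sub_distrib, ← Finset.sum_add_distrib]
    refine Finset.sum_congr rfl fun m _ => Finset.sum_congr rfl fun q _ => ?_
    rw [bucketCoeff, leftover_eq]
    simp only [Pi.sub_apply]
    ring
  have h3 : ∑ m, ρ / 2 * ∑ q, (w m q - G.stationSolve N U ρ lam y m q) ^ 2
      = ρ / 2 * G.normSq (w - z) := by
    rw [normSq, Finset.mul_sum]; rfl
  rw [← sum_mul_eq_sum_mul_routed (fun q => lam q + ρ * G.residual N y q)]
  linarith

/-! ### Relaxed steps and the Lyapunov inequality -/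

lemma innerStep_eq (y : G.Routing) :
    G.innerStep N U ρ α lam y = y + α • (G.jacobi N U ρ lam y - y) := rfl

lemma normSq_sub_comm (y z : G.Routing) : G.normSq (y - z) = G.normSq (z - y) := by
  simp only [normSq, Pi.sub_apply]
  exact Finset.sum_congr rfl fun m _ => Finset.sum_congr rfl fun q _ => by ring

lemma normSq_sub_combo (w y z : G.Routing) (t : ℝ) :
    G.normSq (w - (y + t • (z - y))) = (1 - t) * G.normSq (w - y) + t * G.normSq (w - z)
      - t * (1 - t) * G.normSq (z - y) := by
  simp only [normSq, Finset.mul_sum]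
  simp only [← Finset.sum_sub_distrib, ← Finset.sum_add_distrib]
  refine Finset.sum_congr rfl fun m _ => Finset.sum_congr rfl fun q _ => ?_
  simp only [Pi.sub_apply, Pi.add_apply, Pi.smul_apply, smul_eq_mul]
  ring

lemma augLagrangian_combo (y z : G.Routing) (t : ℝ) :
    G.augLagrangian N U ρ lam (y + t • (z - y)) = G.augLagrangian N U ρ lam y
      + (G.totalUtility U (y + t • (z - y)) - G.totalUtility U y)
      + t * ∑ q, (lam q + ρ * G.residual N y q) * G.routed (z - y) q
      - ρ / 2 * t ^ 2 * ∑ q, G.routed (z - y) q ^ 2 := by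
  have h1 : ∑ q, lam q * G.residual N (y + t • (z - y)) q
      + ρ / 2 * ∑ q, G.residual N (y + t • (z - y)) q ^ 2
      = ∑ q, lam q * G.residual N y q + ρ / 2 * ∑ q, G.residual N y q ^ 2
      - t * ∑ q, (lam q + ρ * G.residual N y q) * G.routed (z - y) q
      + ρ / 2 * t ^ 2 * ∑ q, G.routed (z - y) q ^ 2 := by
    simp only [Finset.mul_sum]
    simp only [← Finset.sum_sub_distrib, ← Finset.sum_add_distrib]
    refine Finset.sum_congr rfl fun q _ => ?_
    rw [residual_add_smul_sub]
    ring
  rw [augLagrangian_eq, augLagrangian_eq]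
  linarith

/-- The Lyapunov function of the inner loop, relative to the point `w`. -/
noncomputable def innerLyapunov (N : G.RegionFile → ℝ) (U : M → ℝ → ℝ) (ρ β : ℝ)
    (lam : G.Prices) (w y : G.Routing) : ℝ :=
  ρ / 2 * G.normSq (w - y)
    + (1 + 1 / (2 - β)) * (G.augLagrangian N U ρ lam w - G.augLagrangian N U ρ lam y)

/-- Here z is the Jacobi point, p the relaxed point, nd = |z - y|², and P and S are the linear and
quadratic parts of the change of L. The three-point inequality at w bounds the new squared distance
up to the gain Lp - Ly and an overshoot (αρ/2)(β - 2 + α) nd. The weight 1 on the value gap cancels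
the gain, and the weight 1/(2 - β) absorbs the overshoot. -/
lemma lyapunov_scalar {Fw Fy Fz Fp Lw Ly Lp Pw Pd Sw Sd nd nwy nwz : ℝ} (hρ : 0 < ρ)
    (hα0 : 0 < α) (hα1 : α ≤ 1) (hβ2 : β < 2)
    (hJ : Fw + (Pw - Pd) - ρ / 2 * nwy + ρ / 2 * nwz + ρ / 2 * nd ≤ Fz)
    (hJy : Fy + (0 - Pd) - ρ / 2 * 0 + ρ / 2 * nd + ρ / 2 * nd ≤ Fz)
    (hF : (1 - α) * Fy + α * Fz ≤ Fp)
    (hLp : Lp = Ly + (Fp - Fy) + α * Pd - ρ / 2 * α ^ 2 * Sd)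
    (hLw : Lw = Ly + (Fw - Fy) + 1 * Pw - ρ / 2 * 1 ^ 2 * Sw)
    (hS : α * Sd ≤ β * nd) (hSw : 0 ≤ Sw) (hn : 0 ≤ nd) :
    ρ / 2 * ((1 - α) * nwy + α * nwz - α * (1 - α) * nd) + (1 + 1 / (2 - β)) * (Lw - Lp)
      + α * (Lw - Ly) ≤ ρ / 2 * nwy + (1 + 1 / (2 - β)) * (Lw - Ly) := by
  have e1 := mul_le_mul_of_nonneg_left hJ hα0.le
  have e2 := mul_le_mul_of_nonneg_left hJy hα0.le
  have e3 : 0 ≤ α * ρ * Sw := by positivity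
  have e4 := mul_le_mul_of_nonneg_left hS (mul_nonneg hα0.le hρ.le)
  -- Sufficient ascent, from the three-point inequality at w = y: the gain αρ nd exceeds the
  -- coupling loss, which is at most (αρ/2) β nd.
  have hg : α * ρ / 2 * (2 - β) * nd ≤ Lp - Ly := by linarith
  have hg' : α * ρ / 2 * nd ≤ 1 / (2 - β) * (Lp - Ly) := by
    have h1 := mul_le_mul_of_nonneg_left hg (one_div_pos.2 (sub_pos.2 hβ2)).le
    refine le_of_eq_of_le ?_ h1
    have h2 : 2 - β ≠ 0 := (sub_pos.2 hβ2).ne'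
    field_simp
  have e5 : 0 ≤ α * ρ / 2 * nd * ((2 - β) + (1 - α)) :=
    mul_nonneg (by positivity) (by linarith)
  have hexp : (1 + 1 / (2 - β)) * (Lw - Lp)
      = (1 + 1 / (2 - β)) * (Lw - Ly) - (Lp - Ly) - 1 / (2 - β) * (Lp - Ly) := by ring
  rw [hexp]
  subst hLw
  linarith

lemma innerLyapunov_step (hU : ∀ m, IsUtility (U m)) (hN : ∀ q, 0 ≤ N q) (hρ : 0 < ρ)
    (hfin : ∀ m, ContinuousWithinAt (U m) (Ici 0) 0 ∨ ∃ q : G.Served m, 0 < N q.1)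
    (hα0 : 0 < α) (hα1 : α ≤ 1) (hβ : ∀ q, α * ((G.stations q).card : ℝ) ≤ β) (hβ2 : β < 2)
    (lam : G.Prices) {w y : G.Routing} (hw : w ∈ G.primalDomain N U)
    (hy : y ∈ G.primalDomain N U) :
    innerLyapunov N U ρ β lam w (G.innerStep N U ρ α lam y)
        + α * (G.augLagrangian N U ρ lam w - G.augLagrangian N U ρ lam y)
      ≤ innerLyapunov N U ρ β lam w y := by
  have hJ := jacobi_variational hU hN hρ lam y hw
  have hJy := jacobi_variational hU hN hρ lam y hy
  have hz := jacobi_mem hU hN hρ hfin lam y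
  rw [innerLyapunov, innerLyapunov, innerStep_eq]
  set z := G.jacobi N U ρ lam y
  have hF := totalUtility_combo hU hy hz hα0.le hα1
  have hLp := augLagrangian_combo (N := N) (U := U) (ρ := ρ) (lam := lam) y z α
  have hLw := augLagrangian_combo (N := N) (U := U) (ρ := ρ) (lam := lam) y w 1
  rw [one_smul, add_sub_cancel] at hLw
  have hS := sum_routed_sq_le (G := G) hα0.le hβ (z - y)
  have hSw : 0 ≤ ∑ q, G.routed (w - y) q ^ 2 := Finset.sum_nonneg fun _ _ => sq_nonneg _
  have hn := normSq_nonneg (z - y)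
  have hnw := normSq_sub_combo w y z α
  have h0 : G.normSq (y - y) = 0 := by simp [normSq]
  rw [h0, normSq_sub_comm y z] at hJy
  have hsub : ∀ x : G.Routing, ∑ q, (lam q + ρ * G.residual N y q) * G.routed (x - z) q
      = ∑ q, (lam q + ρ * G.residual N y q) * G.routed (x - y) q
        - ∑ q, (lam q + ρ * G.residual N y q) * G.routed (z - y) q := by
    intro x
    rw [← Finset.sum_sub_distrib]
    refine Finset.sum_congr rfl fun q _ => ?_
    simp only [routed_sub]; ring
  rw [hsub w] at hJ
  rw [hsub y] at hJy
  have h00 : ∑ q, (lam q + ρ * G.residual N y q) * G.routed (y - y) q = 0 :=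
    Finset.sum_eq_zero fun q _ => by rw [routed_sub, sub_self, mul_zero]
  rw [h00] at hJy
  rw [hnw]
  exact lyapunov_scalar hρ hα0 hα1 hβ2 hJ hJy hF hLp hLw hS hSw hn

lemma innerStep_mem (hU : ∀ m, IsUtility (U m)) (hN : ∀ q, 0 ≤ N q) (hρ : 0 < ρ)
    (hfin : ∀ m, ContinuousWithinAt (U m) (Ici 0) 0 ∨ ∃ q : G.Served m, 0 < N q.1)
    (hα0 : 0 < α) (hα1 : α ≤ 1) (lam : G.Prices) {y : G.Routing} (hy : y ∈ G.box N) :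
    G.innerStep N U ρ α lam y ∈ G.primalDomain N U := by
  rw [innerStep_eq]
  exact combo_mem_primalDomain hy (jacobi_mem hU hN hρ hfin lam y) hα0 hα1

lemma innerIter_succ (y : G.Routing) (n : ℕ) : G.innerIter N U ρ α lam y (n + 1)
    = G.innerStep N U ρ α lam (G.innerIter N U ρ α lam y n) :=
  Function.iterate_succ_apply' _ _ _

lemma innerIter_mem_box (hU : ∀ m, IsUtility (U m)) (hN : ∀ q, 0 ≤ N q) (hρ : 0 < ρ)
    (hfin : ∀ m, ContinuousWithinAt (U m) (Ici 0) 0 ∨ ∃ q : G.Served m, 0 < N q.1)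
    (hα0 : 0 < α) (hα1 : α ≤ 1) (lam : G.Prices) {y : G.Routing} (hy : y ∈ G.box N) (n : ℕ) :
    G.innerIter N U ρ α lam y n ∈ G.box N := by
  induction n with
  | zero => exact hy
  | succ n ih => rw [innerIter_succ]; exact (innerStep_mem hU hN hρ hfin hα0 hα1 lam ih).1

/-! ### Convergence of the inner iterates -/

lemma tendsto_of_tendsto_normSq {x : ℕ → G.Routing} {y : G.Routing}
    (h : Tendsto (fun n => G.normSq (y - x n)) atTop (𝓝 0)) : Tendsto x atTop (𝓝 y) := by
  refine tendsto_pi_nhds.2 fun m => tendsto_pi_nhds.2 fun q => ?_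
  have h1 := h.sqrt
  rw [Real.sqrt_zero] at h1
  rw [tendsto_iff_dist_tendsto_zero]
  refine squeeze_zero (fun _ => dist_nonneg) (fun n => ?_) h1
  rw [dist_comm, Real.dist_eq, ← Real.sqrt_sq_eq_abs]
  exact Real.sqrt_le_sqrt (sq_le_normSq (y - x n) m q)

lemma exists_card_bound (hα : ∀ q, α * ((G.stations q).card : ℝ) < 2) :
    ∃ β < 2, ∀ q, α * ((G.stations q).card : ℝ) ≤ β := by
  rcases isEmpty_or_nonempty G.RegionFile with h | h
  · exact ⟨0, by norm_num, fun q => h.elim q⟩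
  · obtain ⟨q, hq⟩ := Finite.exists_max fun q => α * ((G.stations q).card : ℝ)
    exact ⟨_, hα q, hq⟩

/-- The Lyapunov decrease makes the value gaps summable, so every cluster point maximizes L.
Relative to such a point the Lyapunov function is antitone and tends to 0 along a subsequence, hence
along the whole sequence, and it dominates the squared distance. -/
theorem innerIter_converges (hU : ∀ m, IsUtility (U m)) (hN : ∀ q, 0 ≤ N q) (hρ : 0 < ρ)
    (hfin : ∀ m, ContinuousWithinAt (U m) (Ici 0) 0 ∨ ∃ q : G.Served m, 0 < N q.1)
    (hα0 : 0 < α) (hα1 : α ≤ 1) (hα : ∀ q, α * ((G.stations q).card : ℝ) < 2)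
    (lam : G.Prices) {y₀ : G.Routing} (hy₀ : y₀ ∈ G.box N) :
    ∃ y ∈ G.primalDomain N U, Tendsto (G.innerIter N U ρ α lam y₀) atTop (𝓝 y) ∧
      IsMaxOn (G.augLagrangian N U ρ lam) (G.primalDomain N U) y := by
  obtain ⟨β, hβ2, hβ⟩ := exists_card_bound hα
  -- The start vector may have infinite negative utility; after one step all iterates lie in the
  -- primal domain.
  set x : ℕ → G.Routing := fun n => G.innerIter N U ρ α lam y₀ (n + 1) with hx
  have hxbox := innerIter_mem_box hU hN hρ hfin hα0 hα1 lam hy₀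
  have hxd : ∀ n, x n ∈ G.primalDomain N U := fun n => by
    rw [hx]; simp only [innerIter_succ]
    exact innerStep_mem hU hN hρ hfin hα0 hα1 lam (hxbox n)
  have hstep : ∀ w ∈ G.primalDomain N U, ∀ n, innerLyapunov N U ρ β lam w (x (n + 1))
      + α * (G.augLagrangian N U ρ lam w - G.augLagrangian N U ρ lam (x n))
      ≤ innerLyapunov N U ρ β lam w (x n) := fun w hw n => by
    have := innerLyapunov_step hU hN hρ hfin hα0 hα1 hβ hβ2 lam hw (hxd n)
    rwa [← innerIter_succ] at this
  have hgap : ∀ w, IsMaxOn (G.augLagrangian N U ρ lam) (G.primalDomain N U) w → ∀ n,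
      0 ≤ G.augLagrangian N U ρ lam w - G.augLagrangian N U ρ lam (x n) := fun w hw n =>
    sub_nonneg.2 (hw (hxd n))
  have hc : 0 < 1 + 1 / (2 - β) := by
    have := one_div_pos.2 (sub_pos.2 hβ2)
    linarith
  have hVnorm : ∀ w, IsMaxOn (G.augLagrangian N U ρ lam) (G.primalDomain N U) w → ∀ n,
      ρ / 2 * G.normSq (w - x n) ≤ innerLyapunov N U ρ β lam w (x n) := fun w hw n =>
    le_add_of_nonneg_right (mul_nonneg hc.le (hgap w hw n))
  have hV0 : ∀ w, IsMaxOn (G.augLagrangian N U ρ lam) (G.primalDomain N U) w → ∀ n,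
      0 ≤ innerLyapunov N U ρ β lam w (x n) := fun w hw n =>
    (mul_nonneg (half_pos hρ).le (normSq_nonneg _)).trans (hVnorm w hw n)
  obtain ⟨w, hw, hmax⟩ := exists_isMaxOn_augLagrangian hU ρ lam ⟨_, hxd 0⟩
  have hvalue : Tendsto (fun n => G.augLagrangian N U ρ lam (x n)) atTop
      (𝓝 (G.augLagrangian N U ρ lam w)) := by
    have hsum : Summable fun n =>
        α * (G.augLagrangian N U ρ lam w - G.augLagrangian N U ρ lam (x n)) := by
      refine summable_of_sum_range_le (c := innerLyapunov N U ρ β lam w (x 0))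
        (fun n => mul_nonneg hα0.le (hgap w hmax n)) fun n => ?_
      have h1 := Finset.sum_le_sum (s := Finset.range n) fun i _ =>
        le_sub_iff_add_le'.2 (hstep w hw i)
      rw [Finset.sum_range_sub'] at h1
      linarith [hV0 w hmax n]
    have h2 := hsum.tendsto_atTop_zero.const_mul α⁻¹
    simp only [inv_mul_cancel_left₀ hα0.ne', mul_zero] at h2
    simpa using tendsto_const_nhds (x := G.augLagrangian N U ρ lam w).sub h2
  obtain ⟨y, -, φ, hφ, hφy⟩ := isCompact_box.tendsto_subseq (x := x) fun n => (hxd n).1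
  have hcont : Continuous fun y => ∑ q, lam q * G.residual N y q
      + ρ / 2 * ∑ q, G.residual N y q ^ 2 := by
    have := fun q => continuous_residual (N := N) q
    fun_prop
  have hvalue' := hvalue.comp hφ.tendsto_atTop
  -- Convergent values of L bound the total utility from below along the subsequence, which is what
  -- places the cluster point in the domain.
  have hFlim : Tendsto (fun n => G.totalUtility U (x (φ n))) atTop
      (𝓝 (G.augLagrangian N U ρ lam w + (∑ q, lam q * G.residual N y q
        + ρ / 2 * ∑ q, G.residual N y q ^ 2))) := by
    refine (hvalue'.add ((hcont.tendsto y).comp hφy)).congr fun n => ?_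
    simp only [Function.comp, augLagrangian_eq]; ring
  have hy : y ∈ G.primalDomain N U := mem_primalDomain_of_tendsto hU hφy (fun n => hxd _)
    ((hFlim.eventually (lt_mem_nhds (sub_one_lt _))).mono fun n hn => hn.le)
  have hyval : G.augLagrangian N U ρ lam y = G.augLagrangian N U ρ lam w := by
    have := tendsto_nhds_unique hFlim (tendsto_totalUtility hU hφy (fun n => hxd _) hy)
    rw [augLagrangian_eq y]
    linarith
  have hymax : IsMaxOn (G.augLagrangian N U ρ lam) (G.primalDomain N U) y := fun z hz => by
    have := hmax hz
    simp only [mem_ofPred_eq] at this ⊢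
    rwa [hyval]
  refine ⟨y, hy, ?_, hymax⟩
  have hanti : Antitone fun n => innerLyapunov N U ρ β lam y (x n) :=
    antitone_nat_of_succ_le fun n =>
      (le_add_of_nonneg_right (mul_nonneg hα0.le (hgap y hymax n))).trans (hstep y hy n)
  have hsub : Tendsto (fun n => innerLyapunov N U ρ β lam y (x (φ n))) atTop (𝓝 0) := by
    have h1 := (continuous_normSq.tendsto _).comp (tendsto_const_nhds (x := y).sub hφy)
    have h2 := (h1.const_mul (ρ / 2)).add
      ((tendsto_const_nhds (x := G.augLagrangian N U ρ lam y).sub hvalue').const_mul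
        (1 + 1 / (2 - β)))
    have h0 : G.normSq (y - y) = 0 := by simp [normSq]
    rw [h0, hyval, sub_self, mul_zero, mul_zero, add_zero] at h2
    refine h2.congr fun n => ?_
    simp only [Function.comp, innerLyapunov, hyval]
  have hV := (tendsto_iff_tendsto_subseq_of_antitone hanti hφ.tendsto_atTop).2 hsub
  have hnorm : Tendsto (fun n => G.normSq (y - x n)) atTop (𝓝 0) := by
    have h1 := hV.const_mul (2 / ρ)
    rw [mul_zero] at h1
    refine squeeze_zero (fun n => normSq_nonneg _) (fun n => ?_) h1
    have h2 := mul_le_mul_of_nonneg_left (hVnorm y hymax n) (div_pos two_pos hρ).le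
    refine le_of_eq_of_le ?_ h2
    field_simp
  exact (tendsto_add_atTop_iff_nat 1).1 (tendsto_of_tendsto_normSq hnorm)

end CacheNetwork

/-! ### Lagrange multipliers -/

namespace CacheNetwork

variable {M S F : Type*} [Fintype M] [DecidableEq M] [Fintype S] [Fintype F] [DecidableEq F]
variable {G : CacheNetwork M S F} {N : G.RegionFile → ℝ} {U : M → ℝ → ℝ} {ρ : ℝ}

open Classical in
/-- The routing vector obtained by moving the amount `s` of `q` from station `m'` to `m`. -/
noncomputable def transfer (y : G.Routing) (q : G.RegionFile) (m m' : M) (s : ℝ) : G.Routing :=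
  fun k p => y k p + if p.1 = q then (if k = m then s else if k = m' then -s else 0) else 0

lemma routed_transfer (y : G.Routing) {q : G.RegionFile} {m m' : M} (hne : m ≠ m')
    (hm : m ∈ G.stations q) (hm' : m' ∈ G.stations q) (s : ℝ) (p : G.RegionFile) :
    G.routed (transfer y q m m' s) p = G.routed y p := by
  simp only [routed, transfer, Finset.sum_add_distrib]
  rw [add_eq_left]
  by_cases hp : p = q
  · subst hp
    simp only [if_true]
    have h : ∀ k : G.StationsOf p, (if k.1 = m then s else if k.1 = m' then -s else 0)
        = (if k = ⟨m, hm⟩ then s else 0) + (if k = ⟨m', hm'⟩ then -s else 0) := by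
      intro k
      by_cases h1 : k.1 = m
      · have h2 : k = ⟨m, hm⟩ := Subtype.ext h1
        subst h2
        simp [hne]
      · have h2 : k ≠ ⟨m, hm⟩ := fun h => h1 (congrArg Subtype.val h)
        by_cases h3 : k.1 = m'
        · have h4 : k = ⟨m', hm'⟩ := Subtype.ext h3
          subst h4
          simp [hne.symm]
        · have h4 : k ≠ ⟨m', hm'⟩ := fun h => h3 (congrArg Subtype.val h)
          simp [h1, h2, h3, h4]
    rw [Finset.sum_congr rfl fun k _ => h k, Finset.sum_add_distrib]
    simp
  · simp [hp]

lemma volume_transfer (y : G.Routing) {q : G.RegionFile} {m m' : M}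
    (hm : m ∈ G.stations q) (hm' : m' ∈ G.stations q) (s : ℝ) (k : M) :
    G.volume (transfer y q m m' s k)
      = G.volume (y k) + if k = m then s else if k = m' then -s else 0 := by
  simp only [volume, transfer, Finset.sum_add_distrib]
  rw [add_right_inj]
  by_cases hk : k ∈ G.stations q
  · rw [Finset.sum_eq_single (⟨q, hk⟩ : G.Served k)]
    · simp
    · intro p _ hp
      rw [if_neg fun h => hp (Subtype.ext h)]
    · simp
  · have h1 : k ≠ m := fun h => hk (h ▸ hm)
    have h2 : k ≠ m' := fun h => hk (h ▸ hm')
    simp [h1, h2]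

/-- Transferring s leaves the routed totals unchanged. The strict bound s < y_{m',q} keeps the
volume of the giving station positive, hence in its domain. -/
lemma transfer_le {y : G.Routing} (hy : y ∈ G.crpOptima N U)
    {q : G.RegionFile} {m m' : M} (hne : m ≠ m') (hm : m ∈ G.stations q)
    (hm' : m' ∈ G.stations q) {s : ℝ} (hs : 0 < s) (hsy : s < y m' ⟨q, hm'⟩) :
    U m (G.volume (y m) + s) + U m' (G.volume (y m') - s)
      ≤ U m (G.volume (y m)) + U m' (G.volume (y m')) := by
  have hbox := hy.1.1.1
  have hvol := volume_transfer y hm hm' s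
  have hmem : transfer y q m m' s ∈ G.crpFeasible N U := by
    refine ⟨⟨fun k p => ?_, fun k => ?_⟩, fun p => ?_⟩
    · obtain ⟨p, hp⟩ := p
      have h1 := hbox k ⟨p, hp⟩
      simp only [transfer]
      by_cases hpq : p = q
      · subst hpq
        by_cases hkm : k = m
        · subst hkm
          have h2 : y k ⟨p, hp⟩ + y m' ⟨p, hm'⟩ ≤ N p := by
            rw [← hy.1.2 p, routed]
            have := Finset.sum_le_sum_of_subset_of_nonneg (f := fun k : G.StationsOf p =>
              y k.1 ⟨p, k.2⟩) (Finset.subset_univ {⟨k, hp⟩, ⟨m', hm'⟩})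
              fun k _ _ => (hbox k.1 ⟨p, k.2⟩).1
            rwa [Finset.sum_pair (fun h => hne (congrArg Subtype.val h))] at this
          simp only [if_true]
          constructor <;> linarith
        · by_cases hkm' : k = m'
          · subst hkm'
            simp only [if_true, hkm, if_false]
            constructor <;> linarith [h1.1, h1.2]
          · simpa [hkm, hkm'] using h1
      · simpa [hpq] using h1
    · rw [hvol]
      by_cases hkm : k = m
      · subst hkm
        rw [if_pos rfl]
        exact mem_volumeDomain_of_le (hy.1.1.2 k) (by linarith)
      · by_cases hkm' : k = m'
        · subst hkm'
          rw [if_neg hkm, if_pos rfl]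
          have : y k ⟨q, hm'⟩ ≤ G.volume (y k) :=
            Finset.single_le_sum (f := y k) (fun p _ => (hbox k p).1) (Finset.mem_univ _)
          exact Or.inl (by linarith)
        · simpa [hkm, hkm'] using hy.1.1.2 k
    · rw [routed_transfer y hne hm hm' s p, hy.1.2 p]
  have hle : G.totalUtility U (transfer y q m m' s) ≤ G.totalUtility U y := hy.2 hmem
  have hsplit : ∀ f : M → ℝ, ∑ k, f k
      = f m + (f m' + ∑ k ∈ (Finset.univ.erase m).erase m', f k) := fun f => by
    rw [Finset.add_sum_erase _ f (Finset.mem_erase.2 ⟨hne.symm, Finset.mem_univ m'⟩),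
      Finset.add_sum_erase _ f (Finset.mem_univ m)]
  rw [totalUtility, totalUtility, hsplit, hsplit fun k => U k (G.volume (y k))] at hle
  have hrest : ∑ k ∈ (Finset.univ.erase m).erase m', U k (G.volume (transfer y q m m' s k))
      = ∑ k ∈ (Finset.univ.erase m).erase m', U k (G.volume (y k)) := by
    refine Finset.sum_congr rfl fun k hk => ?_
    simp only [Finset.mem_erase] at hk
    rw [hvol, if_neg hk.2.1, if_neg hk.1, add_zero]
  rw [hrest, hvol, hvol, if_pos rfl, if_neg hne.symm, if_pos rfl, ← sub_eq_add_neg] at hle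
  linarith

/-- At an optimum, the marginal utility of a station is at most that of any station which serves
a positive amount of a common region-file. -/
lemma exists_hasDerivWithinAt_le (hU : ∀ m, IsUtility (U m)) {y : G.Routing}
    (hy : y ∈ G.crpOptima N U) {q : G.RegionFile} {m m' : M} (hne : m ≠ m')
    (hm : m ∈ G.stations q) (hm' : m' ∈ G.stations q) (hpos : 0 < y m' ⟨q, hm'⟩) :
    ∃ d, HasDerivWithinAt (U m) d (Ici 0) (G.volume (y m)) ∧
      d ≤ deriv (U m') (G.volume (y m')) := by
  have hbox := hy.1.1.1
  have hv' : 0 < G.volume (y m') :=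
    hpos.trans_le (Finset.single_le_sum (f := y m') (fun p _ => (hbox m' p).1) (Finset.mem_univ _))
  refine ((hU m).exists_hasDerivWithinAt_le_iff (volume_nonneg hbox m)).2
    ⟨hy.1.1.2 m, fun w hw => ?_⟩
  set v := G.volume (y m)
  set v' := G.volume (y m')
  -- The loss per unit transferred tends to the marginal utility of the giver. By concavity the gain
  -- per unit of the receiver is at least its secant slope to any fixed w, so these secants are
  -- bounded. In particular the receiver cannot have infinite slope.
  have hslope : Tendsto (fun s => s⁻¹ * (U m' v' - U m' (v' - s))) (𝓝[>] 0)
      (𝓝 (deriv (U m') v')) := by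
    have h1 := ((hU m').hasDerivAt hv').tendsto_slope_zero_left
    have h2 : Tendsto (fun s : ℝ => -s) (𝓝[>] 0) (𝓝[<] 0) := by
      simpa using tendsto_neg_nhdsGT (a := (0 : ℝ))
    refine (h1.comp h2).congr fun s => ?_
    simp only [Function.comp, smul_eq_mul, inv_neg, ← sub_eq_add_neg]
    ring
  have hlim := (hslope.mul_const (w - v)).const_add (U m v)
  refine ge_of_tendsto hlim ?_
  filter_upwards [Ioo_mem_nhdsGT (lt_min hpos (sub_pos.2 hw))] with s hs
  have hs0 : 0 < s := hs.1
  have hsy := hs.2.trans_le (min_le_left _ _)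
  have hsw := hs.2.trans_le (min_le_right _ _)
  have h1 := transfer_le hy hne hm hm' hs0 hsy
  have h2 := (hU m).concaveOn.slope_anti (hy.1.1.2 m)
    ⟨mem_volumeDomain_of_le (hy.1.1.2 m) (by linarith : v ≤ v + s), (by linarith : v < v + s).ne'⟩
    ⟨mem_volumeDomain_of_le (hy.1.1.2 m) hw.le, hw.ne'⟩ (by linarith : v + s ≤ w)
  rw [slope_def_field, slope_def_field, div_le_iff₀ (sub_pos.2 hw), add_sub_cancel_left] at h2
  have h3 : (U m (v + s) - U m v) / s ≤ s⁻¹ * (U m' v' - U m' (v' - s)) := by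
    rw [div_eq_inv_mul]
    exact mul_le_mul_of_nonneg_left (by linarith) (inv_pos.2 hs0).le
  have h4 := mul_le_mul_of_nonneg_right h3 (sub_pos.2 hw).le
  linarith

/-- Prices that support the optimal value `V` of CRP. -/
def IsMultiplier (N : G.RegionFile → ℝ) (U : M → ℝ → ℝ) (V : ℝ) (lam : G.Prices) : Prop :=
  ∀ w ∈ G.primalDomain N U, G.totalUtility U w - ∑ q, lam q * G.residual N w q ≤ V

lemma residual_eq_zero {y : G.Routing} (hy : y ∈ G.crpFeasible N U) (q : G.RegionFile) :
    G.residual N y q = 0 := by rw [residual, hy.2, sub_self]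

/-- The price of q is minus the largest marginal utility among its stations. Then the gradient of
the Lagrangian at y is nonpositive in every coordinate and vanishes where y_{m,q} > 0, and concavity
turns this into global maximality. -/
theorem exists_isMultiplier (hU : ∀ m, IsUtility (U m)) (hN : ∀ q, 0 ≤ N q) {y : G.Routing}
    (hy : y ∈ G.crpOptima N U) : ∃ lam : G.Prices, IsMultiplier N U (G.totalUtility U y) lam := by
  have hbox := hy.1.1.1
  set d : M → ℝ := fun m => derivWithin (U m) (Ici 0) (G.volume (y m)) with hd
  have hvol : ∀ {m : M} (q : G.Served m), 0 < y m q → 0 < G.volume (y m) := fun q hq =>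
    hq.trans_le (Finset.single_le_sum (f := y _) (fun p _ => (hbox _ p).1) (Finset.mem_univ q))
  have hdeq : ∀ {m : M} {e : ℝ}, HasDerivWithinAt (U m) e (Ici 0) (G.volume (y m)) → d m = e :=
    fun {m e} he => he.derivWithin (uniqueDiffOn_Ici 0 _ (volume_nonneg hbox m))
  have hdpos : ∀ {m : M}, 0 < G.volume (y m) → d m = deriv (U m) (G.volume (y m)) :=
    fun hv => hdeq ((hU _).hasDerivAt hv).hasDerivWithinAt
  -- A station with volume 0 and a positive request shares that request with a station that serves
  -- it, so the exchange argument gives a finite slope. If all its requests are 0, its routing is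
  -- fixed, and the default value of `derivWithin` does no harm.
  have hregular : ∀ m, HasDerivWithinAt (U m) (d m) (Ici 0) (G.volume (y m)) ∨
      ∀ q : G.Served m, N q.1 = 0 := by
    intro m
    rcases (volume_nonneg hbox m).eq_or_lt with hv | hv
    · by_cases hz : ∀ q : G.Served m, N q.1 = 0
      · exact Or.inr hz
      push Not at hz
      obtain ⟨q, hq⟩ := hz
      have hr : 0 < G.routed y q.1 := by rw [hy.1.2]; exact (hN _).lt_of_ne' hq
      obtain ⟨k, hk⟩ : ∃ k : G.StationsOf q.1, 0 < y k.1 ⟨q.1, k.2⟩ := by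
        by_contra! hcon
        exact absurd (Finset.sum_nonpos fun k _ => hcon k) (not_le.2 hr)
      have hne : m ≠ k.1 := by
        intro hmk
        rw [hmk] at hv
        exact (hvol _ hk).ne hv
      obtain ⟨e, he, -⟩ := exists_hasDerivWithinAt_le hU hy hne q.2 k.2 hk
      exact Or.inl (hdeq he ▸ he)
    · exact Or.inl (hdpos hv ▸ ((hU m).hasDerivAt hv).hasDerivWithinAt)
  refine ⟨fun q => -(G.stations q).sup' (stations_nonempty q) d, fun w hw => ?_⟩
  set lam : G.Prices := fun q => -(G.stations q).sup' (stations_nonempty q) d with hlam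
  have h1 : G.totalUtility U w ≤ G.totalUtility U y + ∑ m, ∑ q, d m * (w - y) m q := by
    rw [totalUtility, totalUtility, ← Finset.sum_add_distrib]
    refine Finset.sum_le_sum fun m _ => ?_
    rcases hregular m with hm | hm
    · have := (hU m).le_tangent (volume_nonneg hbox m) (hw.2 m) hm
      rw [← volume_sub] at this
      rwa [← Finset.mul_sum]
    · have hwy : w m = y m := by
        ext q
        have h1 := hw.1 m q
        have h2 := hbox m q
        rw [hm q] at h1 h2
        linarith [h1.1, h1.2, h2.1, h2.2]
      simp [hwy]
  have h2 : -∑ q, lam q * G.residual N w q = ∑ m, ∑ q : G.Served m, lam q.1 * (w - y) m q := by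
    rw [sum_mul_eq_sum_mul_routed lam, ← Finset.sum_neg_distrib]
    refine Finset.sum_congr rfl fun q _ => ?_
    rw [routed_sub, hy.1.2, residual]; ring
  have h3 : ∑ m, ∑ q, d m * (w - y) m q + ∑ m, ∑ q : G.Served m, lam q.1 * (w - y) m q ≤ 0 := by
    rw [← Finset.sum_add_distrib]
    refine Finset.sum_nonpos fun m _ => ?_
    rw [← Finset.sum_add_distrib]
    refine Finset.sum_nonpos fun q _ => ?_
    rw [← add_mul, Pi.sub_apply, Pi.sub_apply]
    have hle : d m + lam q.1 ≤ 0 := by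
      have := Finset.le_sup' d q.2
      simp only [hlam]; linarith
    rcases (hbox m q).1.eq_or_lt with h0 | h0
    · rw [← h0, sub_zero]
      exact mul_nonpos_of_nonpos_of_nonneg hle (hw.1 m q).1
    -- Where y_{m,q} > 0, the exchange argument shows that m attains the maximal marginal utility.
    · have hge : (G.stations q.1).sup' (stations_nonempty q.1) d ≤ d m := by
        refine Finset.sup'_le _ _ fun k hk => ?_
        by_cases hkm : k = m
        · rw [hkm]
        · obtain ⟨e, he, hle⟩ := exists_hasDerivWithinAt_le hU hy hkm hk q.2 h0
          rwa [hdeq he, hdpos (hvol q h0)]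
      have : d m + lam q.1 = 0 := le_antisymm hle (by simp only [hlam]; linarith)
      rw [this, zero_mul]
  linarith

end CacheNetwork

/-! ### The outer loop -/

namespace CacheNetwork

variable {M S F : Type*} [Fintype M] [DecidableEq M] [Fintype S] [Fintype F] [DecidableEq F]
variable {G : CacheNetwork M S F} {N : G.RegionFile → ℝ} {U : M → ℝ → ℝ} {ρ α : ℝ}

lemma dualUpdate_eq (lam : G.Prices) (y : G.Routing) (q : G.RegionFile) :
    G.dualUpdate N ρ lam y q = lam q + ρ * G.residual N y q := rfl

/-! ### Weak and strong duality -/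

lemma augLagrangian_of_feasible {y : G.Routing} (hy : y ∈ G.crpFeasible N U) (lam : G.Prices) :
    G.augLagrangian N U ρ lam y = G.totalUtility U y := by
  simp [augLagrangian_eq, residual_eq_zero hy]

lemma totalUtility_le_dualObjective (hU : ∀ m, IsUtility (U m)) {y : G.Routing}
    (hy : y ∈ G.crpFeasible N U) (lam : G.Prices) :
    G.totalUtility U y ≤ G.dualObjective N U ρ lam := by
  obtain ⟨z, -, hmax⟩ := exists_isMaxOn_augLagrangian hU ρ lam ⟨y, hy.1⟩
  rw [← augLagrangian_of_feasible (ρ := ρ) hy lam]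
  refine le_csSup ⟨G.augLagrangian N U ρ lam z, ?_⟩ (mem_image_of_mem _ hy.1)
  rintro _ ⟨x, hx, rfl⟩
  exact hmax hx

lemma IsMultiplier.dualObjective_eq (hU : ∀ m, IsUtility (U m)) (hρ : 0 < ρ) {y : G.Routing}
    (hy : y ∈ G.crpFeasible N U) {lam : G.Prices}
    (h : IsMultiplier N U (G.totalUtility U y) lam) :
    G.dualObjective N U ρ lam = G.totalUtility U y := by
  refine le_antisymm (csSup_le ⟨_, mem_image_of_mem _ hy.1⟩ ?_)
    (totalUtility_le_dualObjective hU hy lam)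
  rintro _ ⟨x, hx, rfl⟩
  have h1 := h x hx
  have h2 : 0 ≤ ρ / 2 * ∑ q, G.residual N x q ^ 2 :=
    mul_nonneg (half_pos hρ).le (Finset.sum_nonneg fun _ _ => sq_nonneg _)
  rw [augLagrangian_eq]
  linarith

lemma totalUtility_eq_of_optima {y z : G.Routing} (hy : y ∈ G.crpOptima N U)
    (hz : z ∈ G.crpOptima N U) : G.totalUtility U y = G.totalUtility U z :=
  le_antisymm (hz.2 hy.1) (hy.2 hz.1)

/-- A maximizer of the Augmented Lagrangian maximizes the Lagrangian at the updated prices. -/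
lemma lagrangian_le_of_isMaxOn (hU : ∀ m, IsUtility (U m)) {lam : G.Prices} {y w : G.Routing}
    (hy : y ∈ G.primalDomain N U)
    (hmax : IsMaxOn (G.augLagrangian N U ρ lam) (G.primalDomain N U) y)
    (hw : w ∈ G.primalDomain N U) :
    G.totalUtility U w - ∑ q, G.dualUpdate N ρ lam y q * G.residual N w q
      ≤ G.totalUtility U y - ∑ q, G.dualUpdate N ρ lam y q * G.residual N y q := by
  set P := ∑ q, (lam q + ρ * G.residual N y q) * G.routed (w - y) q with hP
  set Q := ∑ q, G.routed (w - y) q ^ 2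
  -- Optimality along the segment from y to w, divided by t. The penalty is second order in t and
  -- disappears as t → 0; its first-order part is what shifts the prices to the updated ones.
  have hbound : ∀ t : ℝ, 0 < t → t ≤ 1 →
      G.totalUtility U w - G.totalUtility U y + P ≤ ρ / 2 * Q * t := by
    intro t ht ht1
    have h1 : G.augLagrangian N U ρ lam (y + t • (w - y)) ≤ G.augLagrangian N U ρ lam y :=
      hmax (combo_mem_primalDomain hy.1 hw ht ht1)
    rw [augLagrangian_combo] at h1
    have h2 := totalUtility_combo hU hy hw ht.le ht1
    refine le_of_mul_le_mul_left ?_ ht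
    linarith
  have hlim : Tendsto (fun t : ℝ => ρ / 2 * Q * t) (𝓝[>] 0) (𝓝 0) := by
    have h1 : Tendsto (fun t : ℝ => ρ / 2 * Q * t) (𝓝 0) (𝓝 (ρ / 2 * Q * 0)) :=
      tendsto_id.const_mul _
    rw [mul_zero] at h1
    exact h1.mono_left nhdsWithin_le_nhds
  have h0 : G.totalUtility U w - G.totalUtility U y + P ≤ 0 := by
    refine ge_of_tendsto hlim ?_
    filter_upwards [Ioc_mem_nhdsGT one_pos] with t ht using hbound t ht.1 ht.2
  have hP' : P = ∑ q, G.dualUpdate N ρ lam y q * G.residual N y q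
      - ∑ q, G.dualUpdate N ρ lam y q * G.residual N w q := by
    rw [hP, ← Finset.sum_sub_distrib]
    refine Finset.sum_congr rfl fun q _ => ?_
    rw [dualUpdate_eq, routed_sub]
    simp only [residual]; ring
  linarith

/-- The squared Euclidean norm of a price vector. -/
def priceSq (lam : G.Prices) : ℝ := ∑ q, lam q ^ 2

lemma priceSq_nonneg (lam : G.Prices) : 0 ≤ priceSq lam :=
  Finset.sum_nonneg fun _ _ => sq_nonneg _

lemma norm_le_sqrt_priceSq (lam : G.Prices) : ‖lam‖ ≤ √(priceSq lam) := by
  refine (pi_norm_le_iff_of_nonneg (Real.sqrt_nonneg _)).2 fun q => ?_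
  rw [Real.norm_eq_abs, ← Real.sqrt_sq_eq_abs]
  exact Real.sqrt_le_sqrt (Finset.single_le_sum (f := fun q => lam q ^ 2)
    (fun _ _ => sq_nonneg _) (Finset.mem_univ q))

/-- One (possibly inexact) step of the outer loop decreases the distance to the multipliers. -/
lemma priceSq_dualUpdate_le (hρ : 0 < ρ) {V κ : ℝ} {lam lamS : G.Prices} {y : G.Routing}
    (hS : IsMultiplier N U V lamS) (hy : y ∈ G.primalDomain N U)
    (hκ : V ≤ G.totalUtility U y - ∑ q, G.dualUpdate N ρ lam y q * G.residual N y q + κ) :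
    priceSq (G.dualUpdate N ρ lam y - lamS) + ρ ^ 2 * ∑ q, G.residual N y q ^ 2
      ≤ priceSq (lam - lamS) + 2 * ρ * κ := by
  have h1 := hS y hy
  -- The identity |a + b|² + |b|² = |a|² + 2⟨a + b, b⟩ with a = λ - λ* and b = ρ r. The multiplier
  -- inequality and near-optimality at the new prices bound the inner product of λ⁺ - λ* and r by κ.
  have h2 : priceSq (G.dualUpdate N ρ lam y - lamS) + ρ ^ 2 * ∑ q, G.residual N y q ^ 2
      = priceSq (lam - lamS) + 2 * ρ * (∑ q, G.dualUpdate N ρ lam y q * G.residual N y q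
        - ∑ q, lamS q * G.residual N y q) := by
    simp only [priceSq, Finset.mul_sum, ← Finset.sum_sub_distrib, ← Finset.sum_add_distrib]
    refine Finset.sum_congr rfl fun q _ => ?_
    simp only [Pi.sub_apply, dualUpdate_eq]
    ring
  have h3 := mul_le_mul_of_nonneg_left (show ∑ q, G.dualUpdate N ρ lam y q * G.residual N y q
    - ∑ q, lamS q * G.residual N y q ≤ κ by linarith) (mul_pos two_pos hρ).le
  linarith

lemma tendsto_of_tendsto_priceSq {x : ℕ → G.Prices} {lam : G.Prices}
    (h : Tendsto (fun n => priceSq (x n - lam)) atTop (𝓝 0)) : Tendsto x atTop (𝓝 lam) := by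
  have h1 := h.sqrt
  rw [Real.sqrt_zero] at h1
  rw [tendsto_iff_dist_tendsto_zero]
  refine squeeze_zero (fun _ => dist_nonneg) (fun n => ?_) h1
  rw [dist_eq_norm]
  exact norm_le_sqrt_priceSq _

/-- The outer loop with exact inner maximization. -/
structure IsMultiplierMethod (N : G.RegionFile → ℝ) (U : M → ℝ → ℝ) (ρ : ℝ)
    (lam : ℕ → G.Prices) (y : ℕ → G.Routing) : Prop where
  mem : ∀ t, y t ∈ G.primalDomain N U
  isMax : ∀ t, IsMaxOn (G.augLagrangian N U ρ (lam t)) (G.primalDomain N U) (y t)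
  outer : ∀ t, lam (t + 1) = G.dualUpdate N ρ (lam t) (y t)

namespace IsMultiplierMethod

variable {lam : ℕ → G.Prices} {y : ℕ → G.Routing} {yOpt : G.Routing}

lemma lagrangian_le (h : IsMultiplierMethod N U ρ lam y) (hU : ∀ m, IsUtility (U m))
    {w : G.Routing} (hw : w ∈ G.primalDomain N U) (t : ℕ) :
    G.totalUtility U w - ∑ q, lam (t + 1) q * G.residual N w q
      ≤ G.totalUtility U (y t) - ∑ q, lam (t + 1) q * G.residual N (y t) q := by
  rw [h.outer]
  exact lagrangian_le_of_isMaxOn hU (h.mem t) (h.isMax t) hw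

lemma optimum_le (h : IsMultiplierMethod N U ρ lam y) (hU : ∀ m, IsUtility (U m))
    (hopt : yOpt ∈ G.crpOptima N U) (t : ℕ) : G.totalUtility U yOpt
      ≤ G.totalUtility U (y t) - ∑ q, lam (t + 1) q * G.residual N (y t) q := by
  have := h.lagrangian_le hU hopt.1.1 t
  simpa [residual_eq_zero hopt.1] using this

lemma priceSq_step (h : IsMultiplierMethod N U ρ lam y) (hU : ∀ m, IsUtility (U m)) (hρ : 0 < ρ)
    (hopt : yOpt ∈ G.crpOptima N U) {lamS : G.Prices}
    (hS : IsMultiplier N U (G.totalUtility U yOpt) lamS) (t : ℕ) :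
    priceSq (lam (t + 1) - lamS) + ρ ^ 2 * ∑ q, G.residual N (y t) q ^ 2
      ≤ priceSq (lam t - lamS) := by
  have h1 := h.optimum_le hU hopt t
  rw [h.outer] at h1 ⊢
  have := priceSq_dualUpdate_le hρ hS (h.mem t) (κ := 0) (lam := lam t) (by rwa [add_zero])
  simpa using this

lemma antitone_priceSq (h : IsMultiplierMethod N U ρ lam y) (hU : ∀ m, IsUtility (U m))
    (hρ : 0 < ρ) (hopt : yOpt ∈ G.crpOptima N U) {lamS : G.Prices}
    (hS : IsMultiplier N U (G.totalUtility U yOpt) lamS) :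
    Antitone fun t => priceSq (lam t - lamS) :=
  antitone_nat_of_succ_le fun t => (le_add_of_nonneg_right (mul_nonneg (sq_nonneg ρ)
    (Finset.sum_nonneg fun _ _ => sq_nonneg _))).trans (h.priceSq_step hU hρ hopt hS t)

lemma tendsto_residual (h : IsMultiplierMethod N U ρ lam y) (hU : ∀ m, IsUtility (U m))
    (hρ : 0 < ρ) (hopt : yOpt ∈ G.crpOptima N U) {lamS : G.Prices}
    (hS : IsMultiplier N U (G.totalUtility U yOpt) lamS) (q : G.RegionFile) :
    Tendsto (fun t => G.residual N (y t) q) atTop (𝓝 0) := by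
  have hsum : Summable fun t => ρ ^ 2 * ∑ q, G.residual N (y t) q ^ 2 := by
    refine summable_of_sum_range_le (c := priceSq (lam 0 - lamS))
      (fun t => mul_nonneg (sq_nonneg ρ) (Finset.sum_nonneg fun _ _ => sq_nonneg _)) fun n => ?_
    have h1 := Finset.sum_le_sum (s := Finset.range n) fun t _ =>
      le_sub_iff_add_le'.2 (h.priceSq_step hU hρ hopt hS t)
    rw [Finset.sum_range_sub'] at h1
    linarith [priceSq_nonneg (lam n - lamS)]
  have h1 := hsum.tendsto_atTop_zero.sqrt
  rw [Real.sqrt_zero] at h1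
  have h2 : Tendsto (fun t => ρ * G.residual N (y t) q) atTop (𝓝 0) := by
    refine squeeze_zero_norm (fun t => ?_) h1
    rw [Real.norm_eq_abs, ← Real.sqrt_sq_eq_abs, mul_pow]
    exact Real.sqrt_le_sqrt (mul_le_mul_of_nonneg_left (Finset.single_le_sum
      (f := fun q => G.residual N (y t) q ^ 2) (fun _ _ => sq_nonneg _) (Finset.mem_univ q))
      (sq_nonneg ρ))
  have h3 := h2.const_mul ρ⁻¹
  simpa only [inv_mul_cancel_left₀ hρ.ne', mul_zero] using h3

lemma mem_closedBall (h : IsMultiplierMethod N U ρ lam y) (hU : ∀ m, IsUtility (U m))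
    (hρ : 0 < ρ) (hopt : yOpt ∈ G.crpOptima N U) {lamS : G.Prices}
    (hS : IsMultiplier N U (G.totalUtility U yOpt) lamS) (t : ℕ) :
    lam t ∈ Metric.closedBall lamS (√(priceSq (lam 0 - lamS))) := by
  rw [Metric.mem_closedBall, dist_eq_norm]
  exact (norm_le_sqrt_priceSq _).trans
    (Real.sqrt_le_sqrt (h.antitone_priceSq hU hρ hopt hS (Nat.zero_le t)))

lemma tendsto_lam_mul_residual (h : IsMultiplierMethod N U ρ lam y) (hU : ∀ m, IsUtility (U m))
    (hρ : 0 < ρ) (hopt : yOpt ∈ G.crpOptima N U) {lamS : G.Prices}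
    (hS : IsMultiplier N U (G.totalUtility U yOpt) lamS) :
    Tendsto (fun t => ∑ q, lam (t + 1) q * G.residual N (y t) q) atTop (𝓝 0) := by
  set C := √(priceSq (lam 0 - lamS)) + ‖lamS‖
  have hC : ∀ t q, |lam t q| ≤ C := by
    intro t q
    have h1 := mem_closedBall_iff_norm.1 (h.mem_closedBall hU hρ hopt hS t)
    have h2 := norm_le_pi_norm (lam t) q
    rw [Real.norm_eq_abs] at h2
    have h3 := norm_sub_norm_le (lam t) lamS
    linarith
  have : Tendsto (fun t => ∑ q, lam (t + 1) q * G.residual N (y t) q) atTop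
      (𝓝 (∑ _q : G.RegionFile, (0 : ℝ))) := by
    refine tendsto_finsetSum _ fun q _ => ?_
    have h1 := (h.tendsto_residual hU hρ hopt hS q).abs.const_mul C
    rw [abs_zero, mul_zero] at h1
    refine squeeze_zero_norm (fun t => ?_) h1
    rw [Real.norm_eq_abs, abs_mul]
    exact mul_le_mul_of_nonneg_right (hC _ q) (abs_nonneg _)
  simpa using this

/-- The value is squeezed between the optimality of y(t) for the Lagrangian at the new prices and
the multiplier inequality; both corrections vanish with the residuals because the prices are
bounded. -/
lemma tendsto_totalUtility (h : IsMultiplierMethod N U ρ lam y) (hU : ∀ m, IsUtility (U m))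
    (hρ : 0 < ρ) (hopt : yOpt ∈ G.crpOptima N U) {lamS : G.Prices}
    (hS : IsMultiplier N U (G.totalUtility U yOpt) lamS) :
    Tendsto (fun t => G.totalUtility U (y t)) atTop (𝓝 (G.totalUtility U yOpt)) := by
  have h1 := (h.tendsto_lam_mul_residual hU hρ hopt hS).const_add (G.totalUtility U yOpt)
  have h2 : Tendsto (fun t => ∑ q, lamS q * G.residual N (y t) q) atTop
      (𝓝 (∑ q : G.RegionFile, lamS q * 0)) :=
    tendsto_finsetSum _ fun q _ => (h.tendsto_residual hU hρ hopt hS q).const_mul _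
  have h3 := h2.const_add (G.totalUtility U yOpt)
  simp only [mul_zero, Finset.sum_const_zero, add_zero] at h1 h3
  exact tendsto_of_tendsto_of_tendsto_of_le_of_le h1 h3
    (fun t => by linarith [h.optimum_le hU hopt t])
    (fun t => by linarith [hS _ (h.mem t)])

/-- A cluster point of the prices is itself a multiplier, by passing to the limit in the Lagrangian
inequality. The distance to it is antitone, so the subsequence determines the limit. -/
lemma tendsto_prices (h : IsMultiplierMethod N U ρ lam y) (hU : ∀ m, IsUtility (U m))
    (hρ : 0 < ρ) (hopt : yOpt ∈ G.crpOptima N U) {lamS : G.Prices}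
    (hS : IsMultiplier N U (G.totalUtility U yOpt) lamS) :
    ∃ lamOpt : G.Prices, IsMultiplier N U (G.totalUtility U yOpt) lamOpt ∧
      Tendsto lam atTop (𝓝 lamOpt) := by
  obtain ⟨lamOpt, -, φ, hφ, hlim⟩ := (isCompact_closedBall lamS _).tendsto_subseq
    (x := fun t => lam (t + 1)) fun t => h.mem_closedBall hU hρ hopt hS (t + 1)
  have hmul : IsMultiplier N U (G.totalUtility U yOpt) lamOpt := by
    intro w hw
    have h1 : Tendsto (fun n => G.totalUtility U w - ∑ q, lam (φ n + 1) q * G.residual N w q) atTop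
        (𝓝 (G.totalUtility U w - ∑ q, lamOpt q * G.residual N w q)) :=
      (tendsto_finsetSum _ fun q _ =>
        ((tendsto_pi_nhds.1 hlim q).mul_const _)).const_sub _
    have h2 := ((h.tendsto_totalUtility hU hρ hopt hS).sub
      (h.tendsto_lam_mul_residual hU hρ hopt hS)).comp hφ.tendsto_atTop
    rw [sub_zero] at h2
    exact le_of_tendsto_of_tendsto' h1 h2 fun n => h.lagrangian_le hU hw (φ n)
  refine ⟨lamOpt, hmul, tendsto_of_tendsto_priceSq ?_⟩
  have hφ' : Tendsto (fun n => φ n + 1) atTop atTop :=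
    (tendsto_add_atTop_nat 1).comp hφ.tendsto_atTop
  refine (tendsto_iff_tendsto_subseq_of_antitone (h.antitone_priceSq hU hρ hopt hmul) hφ').2 ?_
  have hc : Continuous fun l : G.Prices => priceSq (l - lamOpt) := by unfold priceSq; fun_prop
  have h1 := (hc.tendsto lamOpt).comp hlim
  simpa [priceSq, Function.comp_def] using h1

lemma tendsto_infDist (h : IsMultiplierMethod N U ρ lam y) (hU : ∀ m, IsUtility (U m))
    (hρ : 0 < ρ) (hopt : yOpt ∈ G.crpOptima N U) {lamS : G.Prices}
    (hS : IsMultiplier N U (G.totalUtility U yOpt) lamS) :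
    Tendsto (fun t => Metric.infDist (y t) (G.crpOptima N U)) atTop (𝓝 0) := by
  refine Metric.tendsto_atTop'.2 fun η hη => ?_
  obtain ⟨κ, hκ, hnear⟩ := infDist_crpOptima_lt hU hopt hη
  have h1 : ∀ᶠ t in atTop, G.totalUtility U yOpt - κ < G.totalUtility U (y t) :=
    (h.tendsto_totalUtility hU hρ hopt hS).eventually (lt_mem_nhds (by linarith))
  have h2 : ∀ᶠ t in atTop, ∀ q, |G.residual N (y t) q| < κ := by
    refine eventually_all.2 fun q => ?_
    have := (h.tendsto_residual hU hρ hopt hS q).abs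
    rw [abs_zero] at this
    exact this.eventually (gt_mem_nhds hκ)
  obtain ⟨n, hn⟩ := eventually_atTop.1 (h1.and h2)
  refine ⟨n, fun t ht => ?_⟩
  rw [Real.dist_eq, sub_zero, abs_of_nonneg Metric.infDist_nonneg]
  exact hnear _ (h.mem t) (hn t ht.le).1.le fun q => ((hn t ht.le).2 q).le

end IsMultiplierMethod

/-! ### Inner loops with a stopping test -/

/-- For bounded prices, a small inner step means that the new vector nearly maximizes the
Lagrangian at the updated prices. -/
lemma innerStep_nearly_optimal (hU : ∀ m, IsUtility (U m)) (hN : ∀ q, 0 ≤ N q) (hρ : 0 < ρ)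
    (hfin : ∀ m, ContinuousWithinAt (U m) (Ici 0) 0 ∨ ∃ q : G.Served m, 0 < N q.1)
    (hα0 : 0 < α) (hα1 : α ≤ 1) {w : G.Routing} (hw : w ∈ G.crpFeasible N U)
    (lamS : G.Prices) (R : ℝ) {κ : ℝ} (hκ : 0 < κ) :
    ∃ δ > 0, ∀ lam ∈ Metric.closedBall lamS R, ∀ y ∈ G.box N,
      ‖G.innerStep N U ρ α lam y - y‖ ≤ δ →
      G.totalUtility U w ≤ G.totalUtility U (G.innerStep N U ρ α lam y)
        - ∑ q, G.dualUpdate N ρ lam (G.innerStep N U ρ α lam y) q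
          * G.residual N (G.innerStep N U ρ α lam y) q + κ := by
  -- A uniform δ comes from compactness: along a sequence of counterexamples with vanishing steps,
  -- prices and vectors converge on a subsequence.
  by_contra! hcon
  choose lam hlam y hy hδ hlt using fun n : ℕ =>
    hcon (1 / ((n : ℝ) + 1)) Nat.one_div_pos_of_nat
  obtain ⟨⟨lam', y'⟩, -, φ, hφ, hlim⟩ := ((isCompact_closedBall lamS R).prod
    (isCompact_box (N := N))).tendsto_subseq (x := fun n => (lam n, y n))
    fun n => ⟨hlam n, hy n⟩
  have hl : Tendsto (fun n => lam (φ n)) atTop (𝓝 lam') := (continuous_fst.tendsto _).comp hlim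
  have hyl : Tendsto (fun n => y (φ n)) atTop (𝓝 y') := (continuous_snd.tendsto _).comp hlim
  set x : ℕ → G.Routing := fun n => G.innerStep N U ρ α (lam (φ n)) (y (φ n))
  set z : ℕ → G.Routing := fun n => G.jacobi N U ρ (lam (φ n)) (y (φ n))
  have hdiff : Tendsto (fun n => x n - y (φ n)) atTop (𝓝 0) :=
    squeeze_zero_norm (fun n => hδ (φ n))
      ((tendsto_one_div_add_atTop_nhds_zero_nat (𝕜 := ℝ)).comp hφ.tendsto_atTop)
  have hxl : Tendsto x atTop (𝓝 y') := by
    have := hdiff.add hyl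
    simpa only [sub_add_cancel, zero_add] using this
  -- The Jacobi point differs from y by the inner step divided by α, so it has the same limit. There
  -- the proximal terms of the three-point inequality cancel.
  have hzl : Tendsto z atTop (𝓝 y') := by
    have h1 := (hdiff.const_smul α⁻¹).add hyl
    rw [smul_zero, zero_add] at h1
    refine h1.congr fun n => ?_
    simp only [x, z, innerStep_eq, add_sub_cancel_left, smul_smul, inv_mul_cancel₀ hα0.ne',
      one_smul, sub_add_cancel]
  have hxd : ∀ n, x n ∈ G.primalDomain N U := fun n =>
    innerStep_mem hU hN hρ hfin hα0 hα1 _ (hy (φ n))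
  have hzd : ∀ n, z n ∈ G.primalDomain N U := fun n => jacobi_mem hU hN hρ hfin _ _
  set E : G.Prices × G.Routing × G.Routing → ℝ := fun p =>
    ∑ q, (p.1 q + ρ * G.residual N p.2.1 q) * G.routed (w - p.2.2) q
      - ρ / 2 * G.normSq (w - p.2.1) + ρ / 2 * G.normSq (w - p.2.2)
      + ρ / 2 * G.normSq (p.2.2 - p.2.1) with hE
  have hEc : Continuous E := by
    have h1 := fun q => (continuous_residual (G := G) (N := N) q)
    have h2 := fun q => (continuous_routed (G := G) q)
    have h3 := continuous_normSq (G := G)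
    fun_prop
  have hEl : Tendsto (fun n => E (lam (φ n), y (φ n), z n)) atTop (𝓝 (E (lam', y', y'))) :=
    (hEc.tendsto _).comp (hl.prodMk_nhds (hyl.prodMk_nhds hzl))
  have hJ : ∀ n, G.totalUtility U w + E (lam (φ n), y (φ n), z n) ≤ G.totalUtility U (z n) :=
    fun n => by
      have := jacobi_variational hU hN hρ (lam (φ n)) (y (φ n)) hw.1
      simp only [hE]
      linarith
  have hlow := hEl.const_add (G.totalUtility U w)
  have hy'd : y' ∈ G.primalDomain N U := mem_primalDomain_of_tendsto hU hzl hzd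
    ((hlow.eventually (lt_mem_nhds (sub_one_lt _))).mono fun n hn => (hn.trans_le (hJ n)).le)
  have h1 := le_of_tendsto_of_tendsto' hlow (tendsto_totalUtility hU hzl hzd hy'd) hJ
  have hDc : Continuous fun p : G.Prices × G.Routing =>
      ∑ q, G.dualUpdate N ρ p.1 p.2 q * G.residual N p.2 q := by
    have h1 := fun q => (continuous_residual (G := G) (N := N) q)
    simp only [dualUpdate_eq]
    fun_prop
  have hDl := (hDc.tendsto (lam', y')).comp (hl.prodMk_nhds hxl)
  have h2 := le_of_tendsto (((tendsto_totalUtility hU hxl hxd hy'd).sub hDl).add_const κ)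
    (Eventually.of_forall fun n => (hlt (φ n)).le)
  -- Feasibility of w makes the routed difference equal to the residual of the limit, so the
  -- limiting inequality is the claim with κ = 0, a contradiction.
  have h3 : E (lam', y', y') = ∑ q, G.dualUpdate N ρ lam' y' q * G.residual N y' q := by
    have h0 : G.normSq (y' - y') = 0 := by simp [normSq]
    simp only [hE, h0, mul_zero, add_zero, sub_add_cancel]
    refine Finset.sum_congr rfl fun q _ => ?_
    rw [dualUpdate_eq, routed_sub, hw.2]; rfl
  linarith

lemma exists_stopsAt {E : Type*} [Norm E] [Sub E] {x : ℕ → E} {ε : ℝ}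
    (h : ∃ t, ‖x (t + 1) - x t‖ ≤ ε) :
    ∃ T, StopsAt x ε (T + 1) ∧ ‖x (T + 1) - x T‖ ≤ ε ∧ ∀ t < T, ε < ‖x (t + 1) - x t‖ := by
  classical
  refine ⟨Nat.find h, ⟨⟨by omega, Nat.find_spec h⟩, ?_⟩, Nat.find_spec h,
    fun t ht => not_le.1 (Nat.find_min h ht)⟩
  rintro k ⟨hk1, hk⟩
  obtain ⟨k, rfl⟩ : ∃ j, k = j + 1 := ⟨k - 1, by omega⟩
  exact Nat.succ_le_succ (Nat.find_min' h hk)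

/-- Until the outer test succeeds, every step is longer than ε and brings the prices closer to a
multiplier by a fixed amount, so the test succeeds eventually. A short last step means small
residuals, and then the Lagrangian inequalities bound the utility on both sides. -/
theorem truncated_scheme (hU : ∀ m, IsUtility (U m)) (hN : ∀ q, 0 ≤ N q) (hρ : 0 < ρ)
    (hfin : ∀ m, ContinuousWithinAt (U m) (Ici 0) 0 ∨ ∃ q : G.Served m, 0 < N q.1)
    (hα0 : 0 < α) (hα1 : α ≤ 1) (lam₀ : G.Prices) {η : ℝ} (hη : 0 < η) :
    ∃ ε₀ > 0, ∀ ε, 0 < ε → ε ≤ ε₀ → ∃ δ₀ > 0, ∀ δ, 0 < δ → δ ≤ δ₀ →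
      ∀ (lam : ℕ → G.Prices) (start y : ℕ → G.Routing), lam 0 = lam₀ →
        G.IsTruncatedRun N U ρ α δ lam start y →
        ∃ T, StopsAt lam ε (T + 1) ∧
          Metric.infDist (y T) (G.crpOptima N U) < η ∧
          ∀ yOpt ∈ G.crpOptima N U, |G.totalUtility U (y T) - G.totalUtility U yOpt| < η := by
  obtain ⟨yO, hO⟩ := crpOptima_nonempty hU hN hfin
  obtain ⟨lamS, hS⟩ := exists_isMultiplier hU hN hO
  obtain ⟨κ₀, hκ₀, hnear⟩ := infDist_crpOptima_lt hU hO hη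
  set V := G.totalUtility U yO
  set R := √(priceSq (lam₀ - lamS))
  -- Bounds the multiplier and the last prices: these are within R of the multiplier before the
  -- final update, which moves them by at most ε ≤ 1.
  set C := ‖lamS‖ + R + 1
  have hC1 : 1 ≤ C := by
    have h1 : 0 ≤ R := Real.sqrt_nonneg _
    have h2 := norm_nonneg lamS
    simp only [C]; linarith
  set n : ℝ := (Fintype.card G.RegionFile : ℝ)
  have hn : 0 ≤ n := Nat.cast_nonneg _
  -- K ε collects the price term n C ε/ρ and one more ε/ρ for the inner error. Taking it at most κ₀
  -- and η/2 gives both conclusions.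
  set K := (n * C + 1) / ρ with hK
  have hKpos : 0 < K := div_pos (by positivity) hρ
  have hKρ : 1 / ρ ≤ K := by
    rw [hK]; gcongr; linarith [mul_nonneg hn (by linarith : 0 ≤ C)]
  refine ⟨min 1 (min κ₀ (η / 2) / K), lt_min one_pos
    (div_pos (lt_min hκ₀ (half_pos hη)) hKpos), fun ε hε hεle => ?_⟩
  have hε1 : ε ≤ 1 := hεle.trans (min_le_left _ _)
  have hKε : K * ε ≤ min κ₀ (η / 2) := by
    have := hεle.trans (min_le_right _ _)
    rwa [le_div_iff₀ hKpos, mul_comm] at this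
  obtain ⟨δ₀, hδ₀, hinner⟩ := innerStep_nearly_optimal hU hN hρ hfin hα0 hα1 hO.1 lamS R
    -- This accuracy costs 2ρκ = ε²/2 per outer step, half of the decrease ε² guaranteed by a step
    -- longer than ε.
    (κ := ε ^ 2 / (4 * ρ)) (by positivity)
  refine ⟨δ₀, hδ₀, fun δ _ hδ lam start y h0 hrun => ?_⟩
  have hstep : ∀ t, lam t ∈ Metric.closedBall lamS R → y t ∈ G.primalDomain N U ∧
      V ≤ G.totalUtility U (y t) - ∑ q, lam (t + 1) q * G.residual N (y t) q
        + ε ^ 2 / (4 * ρ) := by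
    intro t ht
    obtain ⟨τ, ⟨⟨hτ1, hτ⟩, -⟩, hyt⟩ := hrun.inner t
    obtain ⟨σ, rfl⟩ : ∃ σ, τ = σ + 1 := ⟨τ - 1, by omega⟩
    rw [Nat.add_sub_cancel, innerIter_succ] at hτ
    rw [innerIter_succ] at hyt
    have hbox := innerIter_mem_box hU hN hρ hfin hα0 hα1 (lam t) (hrun.start_mem t) σ
    rw [hrun.outer, hyt]
    exact ⟨innerStep_mem hU hN hρ hfin hα0 hα1 _ hbox, hinner _ ht _ hbox (hτ.trans hδ)⟩
  have hball : ∀ t, priceSq (lam t - lamS) ≤ priceSq (lam₀ - lamS) →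
      lam t ∈ Metric.closedBall lamS R := fun t ht => by
    rw [Metric.mem_closedBall, dist_eq_norm]
    exact (norm_le_sqrt_priceSq _).trans (Real.sqrt_le_sqrt ht)
  have hdiff : ∀ t q, (lam (t + 1) - lam t) q = ρ * G.residual N (y t) q := fun t q => by
    rw [hrun.outer, Pi.sub_apply, dualUpdate_eq, add_sub_cancel_left]
  -- The induction also keeps the prices in the ball on which the inner tolerance is valid.
  have hprogress : ∀ t, (∀ k < t, ε < ‖lam (k + 1) - lam k‖) →
      priceSq (lam t - lamS) + t * (ε ^ 2 / 2) ≤ priceSq (lam₀ - lamS) := by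
    intro t
    induction t with
    | zero => intro _; simp [h0]
    | succ t ih =>
      intro hk
      have ih' := ih fun k hkt => hk k (hkt.trans (Nat.lt_succ_self t))
      have hle : priceSq (lam t - lamS) ≤ priceSq (lam₀ - lamS) :=
        (le_add_of_nonneg_right (by positivity)).trans ih'
      obtain ⟨hyd, hopt⟩ := hstep t (hball t hle)
      rw [hrun.outer t] at hopt
      have h1 := priceSq_dualUpdate_le hρ hS hyd hopt
      rw [← hrun.outer t] at h1
      have h2 : ε ^ 2 ≤ ρ ^ 2 * ∑ q, G.residual N (y t) q ^ 2 := by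
        have h3 : priceSq (lam (t + 1) - lam t) = ρ ^ 2 * ∑ q, G.residual N (y t) q ^ 2 := by
          simp only [priceSq, hdiff, mul_pow, Finset.mul_sum]
        rw [← h3]
        have h4 := (hk t (Nat.lt_succ_self t)).le.trans (norm_le_sqrt_priceSq _)
        exact (Real.le_sqrt hε.le (priceSq_nonneg _)).1 h4
      have h5 : 2 * ρ * (ε ^ 2 / (4 * ρ)) = ε ^ 2 / 2 := by field_simp; ring
      push_cast
      linarith
  have hhalts : ∃ t, ‖lam (t + 1) - lam t‖ ≤ ε := by
    by_contra! hcon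
    obtain ⟨t, ht⟩ := exists_nat_gt (priceSq (lam₀ - lamS) / (ε ^ 2 / 2))
    rw [div_lt_iff₀ (by positivity)] at ht
    linarith [hprogress t fun k _ => hcon k, priceSq_nonneg (lam t - lamS)]
  obtain ⟨T, hT, hTε, hTmin⟩ := exists_stopsAt hhalts
  have hlamT := hball T ((le_add_of_nonneg_right (by positivity)).trans (hprogress T hTmin))
  obtain ⟨hyd, hopt⟩ := hstep T hlamT
  have hres : ∀ q, |G.residual N (y T) q| ≤ ε / ρ := fun q => by
    have h1 := (norm_le_pi_norm (lam (T + 1) - lam T) q).trans hTε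
    rw [hdiff, Real.norm_eq_abs, abs_mul, abs_of_pos hρ] at h1
    rw [le_div_iff₀ hρ]; linarith
  have hsum : ∀ μ : G.Prices, ‖μ‖ ≤ C →
      |∑ q, μ q * G.residual N (y T) q| ≤ n * C * (ε / ρ) := fun μ hμ => by
    refine (Finset.abs_sum_le_sum_abs _ _).trans ?_
    refine (Finset.sum_le_card_nsmul _ _ (C * (ε / ρ)) fun q _ => ?_).trans_eq ?_
    · rw [abs_mul]
      exact mul_le_mul ((norm_le_pi_norm μ q).trans hμ) (hres q) (abs_nonneg _) (by linarith)
    · rw [nsmul_eq_mul, Finset.card_univ, mul_assoc]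
  have hs1 := hsum lamS (by
    have : 0 ≤ R := Real.sqrt_nonneg _
    simp only [C]; linarith)
  have hs2 := hsum (lam (T + 1)) (by
    have h1 := norm_sub_norm_le (lam (T + 1)) (lam T)
    have h2 := norm_sub_norm_le (lam T) lamS
    have h3 := mem_closedBall_iff_norm.1 hlamT
    simp only [C]; linarith)
  have hKexp : K * ε = n * C * (ε / ρ) + ε / ρ := by rw [hK]; ring
  have hκε : ε ^ 2 / (4 * ρ) ≤ ε / ρ := by
    rw [div_le_div_iff₀ (by positivity) hρ]
    nlinarith [mul_pos hε hρ, mul_le_mul_of_nonneg_right hε1 (mul_pos hε hρ).le]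
  have hlow : V - K * ε ≤ G.totalUtility U (y T) := by linarith [neg_le_of_abs_le hs2]
  have hup : G.totalUtility U (y T) ≤ V + K * ε := by
    have := hS _ hyd
    linarith [le_of_abs_le hs1, div_pos hε hρ]
  refine ⟨T, hT, hnear _ hyd (by linarith [min_le_left κ₀ (η / 2)]) fun q => ?_,
    fun yOpt hyOpt => ?_⟩
  · have h1 : ε / ρ ≤ K * ε := by
      have := mul_le_mul_of_nonneg_right hKρ hε.le
      rwa [one_div_mul_eq_div] at this
    exact (hres q).trans (h1.trans (hKε.trans (min_le_left _ _)))
  · rw [totalUtility_eq_of_optima hyOpt hO, abs_lt]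
    have := min_le_right κ₀ (η / 2)
    constructor <;> linarith

/-! ### The scheme is distributed -/

lemma innerStep_congr {N N' : G.RegionFile → ℝ} {U U' : M → ℝ → ℝ} {lam lam' : G.Prices}
    {y y' : G.Routing} {m : M} (hU : U m = U' m)
    (h : ∀ q : G.Served m, N q.1 = N' q.1 ∧ lam q.1 = lam' q.1 ∧
      ∀ m' : G.StationsOf q.1, y m'.1 ⟨q.1, m'.2⟩ = y' m'.1 ⟨q.1, m'.2⟩) :
    G.innerStep N U ρ α lam y m = G.innerStep N' U' ρ α lam' y' m := by
  have hN : (fun q : G.Served m => N q.1) = fun q => N' q.1 := funext fun q => (h q).1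
  have hy : ∀ q : G.Served m, y m q = y' m q := fun q => (h q).2.2 ⟨m, q.2⟩
  have ha : G.bucketCoeff N ρ lam y m = G.bucketCoeff N' ρ lam' y' m := by
    ext q
    obtain ⟨h1, h2, h3⟩ := h q
    simp only [bucketCoeff, leftover, h1, h2, h3]
  ext q
  simp only [innerStep, stationSolve, hU, hN, ha, hy]

end CacheNetwork

/-! ### Assembly of the theorem -/

open CacheNetwork in
theorem mainTheorem4 {M S F : Type*} [Fintype M] [DecidableEq M] [Fintype S] [Fintype F]
    [DecidableEq F] (G : CacheNetwork M S F)
    (N : G.RegionFile → ℝ) (hN : ∀ q, 0 ≤ N q)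
    (U : M → ℝ → ℝ) (hU : ∀ m, IsUtility (U m))
    -- a station whose utility is `-∞` at volume `0` can receive some traffic
    (hfin : ∀ m, ContinuousWithinAt (U m) (Ici 0) 0 ∨ ∃ q : G.Served m, 0 < N q.1)
    (ρ : ℝ) (hρ : 0 < ρ)
    (α : ℝ) (hα0 : 0 < α) (hα1 : α ≤ 1) (hα : ∀ q, α * ((G.stations q).card : ℝ) < 2) :
    -- CRP has a global optimum
    (G.crpOptima N U).Nonempty ∧
    -- Bucket-filling terminates and returns the unique solution of the problem of each station
    (∀ (lam : G.Prices) (y : G.Routing) (m : M),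
      BucketFilling.Halted (U m) ρ (fun q => N q.1) (G.bucketCoeff N ρ lam y m)
        (BucketFilling.run (U m) ρ (fun q => N q.1) (G.bucketCoeff N ρ lam y m)
          (2 * Fintype.card (G.Served m))) ∧
      G.stationSolve N U ρ lam y m ∈ G.stationDomain N (U m) m ∧
      ∀ z ∈ G.stationDomain N (U m) m, z ≠ G.stationSolve N U ρ lam y m →
        G.stationObjective N U ρ lam y m z
          < G.stationObjective N U ρ lam y m (G.stationSolve N U ρ lam y m)) ∧
    -- the inner loop converges to a maximizer of the Augmented Lagrangian
    (∀ (lam : G.Prices), ∀ y₀ ∈ G.box N, ∃ y ∈ G.primalDomain N U,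
      Tendsto (G.innerIter N U ρ α lam y₀) atTop (𝓝 y) ∧
      IsMaxOn (G.augLagrangian N U ρ lam) (G.primalDomain N U) y) ∧
    -- the outer loop: the prices converge to a dual optimum, the duality gap is zero, and the
    -- routing vectors converge to the set of global optima of CRP
    (∀ (lam : ℕ → G.Prices) (start y : ℕ → G.Routing), G.IsExactRun N U ρ α lam start y →
      (∃ lamOpt : G.Prices, Tendsto lam atTop (𝓝 lamOpt) ∧
        (∀ μ, G.dualObjective N U ρ lamOpt ≤ G.dualObjective N U ρ μ) ∧
        ∀ yOpt ∈ G.crpOptima N U, G.dualObjective N U ρ lamOpt = G.totalUtility U yOpt) ∧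
      Tendsto (fun t => Metric.infDist (y t) (G.crpOptima N U)) atTop (𝓝 0) ∧
      ∀ yOpt ∈ G.crpOptima N U,
        Tendsto (fun t => G.totalUtility U (y t)) atTop (𝓝 (G.totalUtility U yOpt))) ∧
    -- with stopping tests, the scheme terminates at a point as close to optimal as desired,
    -- once the outer tolerance `ε` is small and the inner tolerance `δ` is small enough for `ε`
    (∀ (lam₀ : G.Prices), ∀ η > 0, ∃ ε₀ > 0, ∀ ε, 0 < ε → ε ≤ ε₀ →
      ∃ δ₀ > 0, ∀ δ, 0 < δ → δ ≤ δ₀ →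
        ∀ (lam : ℕ → G.Prices) (start y : ℕ → G.Routing), lam 0 = lam₀ →
          G.IsTruncatedRun N U ρ α δ lam start y →
          ∃ T, StopsAt lam ε (T + 1) ∧
            Metric.infDist (y T) (G.crpOptima N U) < η ∧
            ∀ yOpt ∈ G.crpOptima N U, |G.totalUtility U (y T) - G.totalUtility U yOpt| < η) ∧
    -- the scheme is distributed: a station needs its own data and utility, and the prices and
    -- the routing variables (its own and its neighbours') of the region-files it can serve
    (∀ (N' : G.RegionFile → ℝ) (U' : M → ℝ → ℝ) (lam lam' : G.Prices) (y y' : G.Routing) (m : M),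
      U m = U' m → (∀ q : G.Served m, N q.1 = N' q.1 ∧ lam q.1 = lam' q.1 ∧
        ∀ m' : G.StationsOf q.1, y m'.1 ⟨q.1, m'.2⟩ = y' m'.1 ⟨q.1, m'.2⟩) →
      G.innerStep N U ρ α lam y m = G.innerStep N' U' ρ α lam' y' m) ∧
    -- and the update of a price needs the data of that region-file only
    (∀ (N' : G.RegionFile → ℝ) (lam lam' : G.Prices) (y y' : G.Routing) (q : G.RegionFile),
      N q = N' q → lam q = lam' q →
      (∀ m : G.StationsOf q, y m.1 ⟨q, m.2⟩ = y' m.1 ⟨q, m.2⟩) →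
      G.dualUpdate N ρ lam y q = G.dualUpdate N' ρ lam' y' q) := by
  refine ⟨crpOptima_nonempty hU hN hfin, fun lam y m => ⟨halted_station hU hN hρ lam y m,
    stationSolve_mem hU hN hρ hfin lam y m,
    fun z hz hne => stationObjective_lt hU hN hρ lam y m hz hne⟩,
    fun lam y₀ hy₀ => innerIter_converges hU hN hρ hfin hα0 hα1 hα lam hy₀, ?_,
    fun lam₀ η hη => truncated_scheme hU hN hρ hfin hα0 hα1 lam₀ hη,
    fun N' U' lam lam' y y' m hUm h => innerStep_congr hUm h, ?_⟩
  · intro lam start y hrun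
    have hmethod : IsMultiplierMethod N U ρ lam y := by
      have hlimit : ∀ t, y t ∈ G.primalDomain N U ∧
          IsMaxOn (G.augLagrangian N U ρ (lam t)) (G.primalDomain N U) (y t) := fun t => by
        obtain ⟨z, hz, hlim, hmax⟩ :=
          innerIter_converges hU hN hρ hfin hα0 hα1 hα (lam t) (hrun.start_mem t)
        -- By uniqueness of limits, the vectors of an exact run are the maximizers found by the
        -- inner loop, whatever the start vectors.
        rw [tendsto_nhds_unique (hrun.inner t) hlim]
        exact ⟨hz, hmax⟩
      exact ⟨fun t => (hlimit t).1, fun t => (hlimit t).2, hrun.outer⟩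
    obtain ⟨yO, hO⟩ := crpOptima_nonempty hU hN hfin
    obtain ⟨lamS, hS⟩ := exists_isMultiplier hU hN hO
    obtain ⟨lamOpt, hmul, hlim⟩ := hmethod.tendsto_prices hU hρ hO hS
    have hdual := hmul.dualObjective_eq hU hρ hO.1
    refine ⟨⟨lamOpt, hlim, fun μ => ?_, fun yOpt hyOpt => ?_⟩,
      hmethod.tendsto_infDist hU hρ hO hS, fun yOpt hyOpt => ?_⟩
    · rw [hdual]
      exact totalUtility_le_dualObjective hU hO.1 μ
    · rw [hdual, totalUtility_eq_of_optima hO hyOpt]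
    · rw [totalUtility_eq_of_optima hyOpt hO]
      exact hmethod.tendsto_totalUtility hU hρ hO hS
  · intro N' lam lam' y y' q h1 h2 h3
    simp only [dualUpdate, routed, h1, h2, h3]
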